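/- Setting. Consider a one-dimensional chain of $N$ coupled oscillators with masses $m_j>0$ and spring constants $k_j\ge 0$, where spring $j$ joins oscillators $j$ and $j+1$ and the last spring joins oscillators $N$ and $1$ (its constant is $0$ for an open chain). Let $B=\sqrt M^{-1}\Phi\sqrt W$, where $M=\mathrm{diag}(m_j)$, $W=\mathrm{diag}(k_j)$ and $\Phi$ is the cyclic incidence matrix with columns $e_j-e_{j+1}$. Pad $B$ with zero rows and columns to size $2^n$, $n=\lceil\log_2 N\rceil$, and let $H=-\begin{pmatrix}0&B\\B^\dagger&0\end{pmatrix}$, acting on $n+1$ signal qubits. A unitary $U$ on $a$ ancilla qubits and the signal qubits is an $(\alpha,a,\varepsilon)$-block-encoding of $A$, where $\alpha\ge0$, if $\|A-\alpha(\langle 0^a|\otimes I)U(|0^a\rangle\otimes I)\|_2\le\varepsilon$. Let $U_H$ be an $(\alpha_H,a_H,0)$-block-encoding of $H$ given as a circuit of $G_H$ elementary (at most two-qubit) gates. Circuits are built from calls of $U_H$ and $U_H^\dagger$, each possibly controlled on one work qubit and each costing $G_H$ gates, and from further gates that do not act on the signal qubits and are counted separately: one- and two-qubit gates on the work qubits,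 and (controlled) phase gates $e^{i\varphi\Pi}$, where $\Pi$ projects onto prescribed values of some work qubits and, optionally, onto $|0^{a_H}\rangle$. For a circuit $V$, let $R=I-2|0\rangle\langle 0|\otimes I$ be the reflection about the all-zero state of all ancillas. Amplifying $V$ with $m$ iterations means running $(-V'RV'^\dagger R)^mV'$, where $V'$ is $V$ together with one rotation of a fresh ancilla qubit. Let $\psi_0$ be an initial vector with $0<\|\psi_0\|_2\le1$ (a normalized state has $\|\psi_0\|_2=1$), prepared as the state $\hat\psi_0=\psi_0/\|\psi_0\|_2$, and let $\log$ be the natural logarithm. Theorem. There is an absolute constant $K$ such that for every such chain, every such $U_H$ and every $t\ge0$ the following holds. (1) Let $0<\varepsilon<1$, $\alpha_{HS}\ge4$ and $D=2\lceil 2.8\,\alpha_H t+\log(1/\varepsilon)\rceil-1$. There is a circuit $V$ that is an $(\alpha_{HS},a_H+3,\varepsilon)$-block-encoding of $e^{-iHt}$ and whose calls cost at most $D\cdot G_H$ gates, with at most $KD$ other gates. For every $\psi_0$ as above, amplifying $V$ with a suitable number $m\le\lceil\alpha_{HS}/\|\psi_0\|_2\rceil$ of iterations gives a circuit whose calls cost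 at most $$\Bigl(2\Bigl\lceil\frac{\alpha_{HS}}{\|\psi_0\|_2}\Bigr\rceil+1\Bigr)\Bigl(2\bigl\lceil 2.8\,\alpha_H t+\log(1/\varepsilon)\bigr\rceil-1\Bigr)G_H$$ gates, with at most $K\bigl(2\lceil\alpha_{HS}/\|\psi_0\|_2\rceil+1\bigr)D$ other gates, and which is an $\varepsilon$-close simulation. That is, on the input $|0\rangle\otimes\hat\psi_0$ the unnormalized signal state flagged by all ancillas being $0$ differs from $e^{-iHt}\hat\psi_0$ by at most $\varepsilon$ in norm, the probability of this flag is at least $1-\varepsilon$, and the normalized post-measurement state is also within $\varepsilon$ of $e^{-iHt}\hat\psi_0$. (2) More generally, let $V$ be any such circuit, with any number of ancillas, that is a block-encoding of $e^{-iHt}$ with any sub-normalization $\alpha_{HS}\geq 0$ and error $\delta$; let its calls cost $G_V$ gates and let it have $g$ other gates. For every $\psi_0$ as above, amplifying $V$ with a suitable number $m\le\lceil\alpha_{HS}/\|\psi_0\|_2\rceil$ of iterations gives a circuit whose calls cost at most $(2\lceil\alpha_{HS}/\|\psi_0\|_2\rceil+1)\,G_V$ gates, with at most $K(2\lceil\alpha_{HS}/\|\psi_0\|_2\rceil+1)(g+1)$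 other gates, and whose flagged output on $|0\rangle\otimes\hat\psi_0$ is within $K\delta$ of $e^{-iHt}\hat\psi_0$. -/

import Mathlib

/-! ### Quantum registers -/

/-- Computational basis states of a register whose qubits are labelled by `ι`. -/
abbrev Reg (ι : Type) : Type := ι → Fin 2

/-- State vectors (with the Euclidean norm) of a register whose qubits are labelled by `ι`. -/
abbrev QState (ι : Type) [Fintype ι] [DecidableEq ι] : Type := EuclideanSpace ℂ (Reg ι)

/-- The operator `u`, acting on qubits labelled by `κ`, applied to the qubits `f k` of a larger
register, and the identity on all its other qubits. -/
noncomputable def onQubits {ι κ : Type} [Fintype ι] [DecidableEq ι] [Fintype κ] [DecidableEq κ]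
    (f : κ ↪ ι) (u : Matrix (Reg κ) (Reg κ) ℂ) : Matrix (Reg ι) (Reg ι) ℂ :=
  Matrix.of fun x y =>
    if ∀ i, (∀ k, f k ≠ i) → x i = y i then u (fun k => x (f k)) (fun k => y (f k)) else 0

/-- The operator `u` controlled on qubit `q` (applied if the qubit is `1`). -/
noncomputable def controlledOn {ι : Type} [Fintype ι] [DecidableEq ι] (q : ι)
    (u : Matrix (Reg ι) (Reg ι) ℂ) : Matrix (Reg ι) (Reg ι) ℂ :=
  Matrix.of fun x y =>
    if x q = y q then (if x q = 1 then u x y else (1 : Matrix (Reg ι) (Reg ι) ℂ) x y) else 0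

/-- The spectral (`ℓ² → ℓ²` operator) norm of a matrix. -/
noncomputable def specNorm {ι : Type} [Fintype ι] [DecidableEq ι]
    (A : Matrix (Reg ι) (Reg ι) ℂ) : ℝ :=
  ‖Matrix.toEuclideanCLM (𝕜 := ℂ) A‖

/-! ### Block encodings: ancilla qubits `α`, signal qubits `σ` -/

/-- The block `(⟨0| ⊗ I) U (|0⟩ ⊗ I)` of an operator on ancilla and signal qubits. -/
def zeroBlock {α σ : Type} (U : Matrix (Reg (α ⊕ σ)) (Reg (α ⊕ σ)) ℂ) :
    Matrix (Reg σ) (Reg σ) ℂ :=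
  Matrix.of fun x y => U (Sum.elim (fun _ => 0) x) (Sum.elim (fun _ => 0) y)

/-- `U` is a block encoding of `A` with sub-normalization `c` and encoding error `ε`;
the ancilla qubits are those labelled by `α`. -/
structure IsBlockEncoding {α σ : Type} [Fintype α] [DecidableEq α] [Fintype σ] [DecidableEq σ]
    (c ε : ℝ) (U : Matrix (Reg (α ⊕ σ)) (Reg (α ⊕ σ)) ℂ) (A : Matrix (Reg σ) (Reg σ) ℂ) :
    Prop where
  unitary : U ∈ Matrix.unitaryGroup (Reg (α ⊕ σ)) ℂ
  nonneg : 0 ≤ c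
  error_le : specNorm (A - (c : ℂ) • zeroBlock U) ≤ ε

/-- The state `|0⟩ ⊗ ψ`. -/
noncomputable def withZeroAncilla {α σ : Type} [Fintype α] [DecidableEq α] [Fintype σ]
    [DecidableEq σ] (ψ : QState σ) : QState (α ⊕ σ) :=
  WithLp.toLp 2 fun x => if ∀ i, x (Sum.inl i) = 0 then ψ (fun j => x (Sum.inr j)) else 0

/-- The (unnormalized) signal state `(⟨0| ⊗ I) φ` that is left when the ancilla qubits are
measured to be all `0`; the squared norm is the probability of that outcome. -/
noncomputable def flagged {α σ : Type} [Fintype α] [DecidableEq α] [Fintype σ]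
    [DecidableEq σ] (φ : QState (α ⊕ σ)) : QState σ :=
  WithLp.toLp 2 fun x => φ (Sum.elim (fun _ => 0) x)

/-- The state `A ψ`. -/
noncomputable def applyOp {ι : Type} [Fintype ι] [DecidableEq ι]
    (A : Matrix (Reg ι) (Reg ι) ℂ) (ψ : QState ι) : QState ι :=
  Matrix.toEuclideanCLM (𝕜 := ℂ) A ψ

/-! ### Elementary circuits -/

/-- An elementary gate: an arbitrary unitary on at most two qubits. -/
structure LocalGate (ι : Type) where
  arity : ℕ
  arity_le : arity ≤ 2
  wires : Fin arity ↪ ι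
  op : Matrix.unitaryGroup (Reg (Fin arity)) ℂ

namespace LocalGate

noncomputable def eval {ι : Type} [Fintype ι] [DecidableEq ι] (g : LocalGate ι) :
    Matrix (Reg ι) (Reg ι) ℂ :=
  onQubits g.wires (g.op : Matrix (Reg (Fin g.arity)) (Reg (Fin g.arity)) ℂ)

/-- The inverse gate. -/
noncomputable def dagger {ι : Type} (g : LocalGate ι) : LocalGate ι :=
  { g with op := g.op⁻¹ }

/-- The same gate in a larger register. -/
def lift {ι κ : Type} (f : ι ↪ κ) (g : LocalGate ι) : LocalGate κ :=
  { g with wires := g.wires.trans f }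

end LocalGate

/-- The unitary of a list of elementary gates; the head of the list is applied first. -/
noncomputable def evalLocal {ι : Type} [Fintype ι] [DecidableEq ι] :
    List (LocalGate ι) → Matrix (Reg ι) (Reg ι) ℂ
  | [] => 1
  | g :: c => evalLocal c * g.eval

/-! ### Circuits that call a block encoding

The register consists of `b` work qubits, the `a` ancilla qubits of a given block encoding `U`,
and `s` signal qubits. The signal qubits are touched by calls of `U` and `U†` only. -/

/-- The qubits of such a circuit. -/
abbrev Wires (b a s : ℕ) : Type := (Fin b ⊕ Fin a) ⊕ Fin s

/-- The qubits on which the called block encoding acts. -/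
def callWires (b a s : ℕ) : Fin a ⊕ Fin s ↪ Wires b a s where
  toFun := Sum.map Sum.inr id
  inj' := Sum.map_injective.mpr ⟨Sum.inr_injective, Function.injective_id⟩

inductive Gate (b a : ℕ) : Type
  /-- a call of `U` (or of `U†` if `inv` is true), possibly controlled on one work qubit -/
  | call (ctrl : Option (Fin b)) (inv : Bool) : Gate b a
  /-- a one- or two-qubit gate on the work qubits -/
  | work (g : LocalGate (Fin b)) : Gate b a
  /-- a (controlled) projector-controlled phase gate: the phase `exp (i φ)` on the basis states
  in which every work qubit `q` with `p q = some v` has the value `v` and, if `z` is true, all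
  ancilla qubits of the called block encoding are `0` -/
  | phase (φ : ℝ) (p : Fin b → Option (Fin 2)) (z : Bool) : Gate b a

namespace Gate

variable {b a : ℕ}

noncomputable def eval {s : ℕ} (U : Matrix (Reg (Fin a ⊕ Fin s)) (Reg (Fin a ⊕ Fin s)) ℂ) :
    Gate b a → Matrix (Reg (Wires b a s)) (Reg (Wires b a s)) ℂ
  | call none inv => onQubits (callWires b a s) (if inv then U.conjTranspose else U)
  | call (some q) inv =>
      controlledOn (Sum.inl (Sum.inl q))
        (onQubits (callWires b a s) (if inv then U.conjTranspose else U))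
  | work g => (g.lift (Function.Embedding.inl.trans Function.Embedding.inl)).eval
  | phase φ p z => Matrix.diagonal fun x =>
      open Classical in
      if (∀ q v, p q = some v → x (Sum.inl (Sum.inl q)) = v) ∧
          (z = true → ∀ j, x (Sum.inl (Sum.inr j)) = 0)
      then Complex.exp (Complex.I * φ) else 1

/-- The inverse gate. -/
noncomputable def dagger : Gate b a → Gate b a
  | call c inv => call c (!inv)
  | work g => work g.dagger
  | phase φ p z => phase (-φ) p z

/-- The same gate in the presence of one more work qubit (the last one). -/
def lift : Gate b a → Gate (b + 1) a
  | call c inv => call (c.map Fin.castSucc) inv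
  | work g => work (g.lift Fin.castSuccEmb)
  | phase φ p z => phase φ (Fin.snoc (α := fun _ => Option (Fin 2)) p none) z

/-- Whether the gate is a call of the block encoding. -/
def isCall : Gate b a → Bool
  | call _ _ => true
  | _ => false

end Gate

/-- A circuit; the head of the list is applied first. -/
abbrev Circuit (b a : ℕ) : Type := List (Gate b a)

namespace Circuit

variable {b a : ℕ}

noncomputable def eval {s : ℕ} (U : Matrix (Reg (Fin a ⊕ Fin s)) (Reg (Fin a ⊕ Fin s)) ℂ) :
    Circuit b a → Matrix (Reg (Wires b a s)) (Reg (Wires b a s)) ℂ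
  | [] => 1
  | g :: c => eval U c * g.eval U

/-- The number of (controlled) calls of the block encoding or its inverse. -/
def calls (c : Circuit b a) : ℕ := c.countP fun g => g.isCall

/-- The number of all other gates. -/
def otherGates (c : Circuit b a) : ℕ := c.countP fun g => !g.isCall

/-- The number of gates spent in the calls, when each (controlled) call of the block encoding or
its inverse costs `G` gates. -/
def callCost (G : ℕ) (c : Circuit b a) : ℕ := c.calls * G

/-- The inverse circuit. -/
noncomputable def dagger (c : Circuit b a) : Circuit b a := (c.map Gate.dagger).reverse

/-- The rotation by the angle `θ` (that is, `R_y(2θ)`) of one qubit. -/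
noncomputable def rotation (θ : ℝ) : Matrix (Reg (Fin 1)) (Reg (Fin 1)) ℂ :=
  Matrix.of fun x y =>
    if x 0 = y 0 then (Real.cos θ : ℂ) else if x 0 = 1 then (Real.sin θ : ℂ) else -(Real.sin θ : ℂ)

theorem rotation_mem (θ : ℝ) : rotation θ ∈ Matrix.unitaryGroup (Reg (Fin 1)) ℂ := by
  rw [Matrix.mem_unitaryGroup_iff]
  ext x y
  have h : (Real.cos θ : ℂ) * Real.cos θ + (Real.sin θ : ℂ) * Real.sin θ = 1 := by
    have := Real.sin_sq_add_cos_sq θ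
    have h2 : ((Real.sin θ ^ 2 + Real.cos θ ^ 2 : ℝ) : ℂ) = 1 := by rw [this]; simp
    push_cast at h2 ⊢
    linear_combination h2
  rw [Matrix.mul_apply, ← (Equiv.funUnique (Fin 1) (Fin 2)).symm.sum_comp]
  obtain ⟨x, rfl⟩ := (Equiv.funUnique (Fin 1) (Fin 2)).symm.surjective x
  obtain ⟨y, rfl⟩ := (Equiv.funUnique (Fin 1) (Fin 2)).symm.surjective y
  rw [Fin.sum_univ_two]
  fin_cases x <;> fin_cases y <;>
    simp [rotation, Matrix.star_apply, Equiv.funUnique, -Complex.ofReal_cos,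
      -Complex.ofReal_sin, Complex.conj_ofReal, mul_comm, funext_iff] <;>
    linear_combination h

/-- The circuit `c` together with a rotation of a new work qubit. The new qubit is one more ancilla
that has to be found in `0`; the all-zero block of `c` is multiplied by `cos θ`. -/
noncomputable def damp (θ : ℝ) (c : Circuit b a) : Circuit (b + 1) a :=
  c.map Gate.lift ++
    [Gate.work ⟨1, by norm_num, ⟨fun _ => Fin.last b, fun _ _ _ => Subsingleton.elim _ _⟩,
      ⟨rotation θ, rotation_mem θ⟩⟩]

/-- The reflection `I - 2 |0⟩⟨0| ⊗ I` about the all-zero state of all ancilla qubits. -/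
noncomputable def reflection : Gate b a := Gate.phase Real.pi (fun _ => some 0) true

/-- The global phase `-1`. -/
noncomputable def negOne : Gate b a := Gate.phase Real.pi (fun _ => none) false

/-- The oblivious Grover iteration `W = - C R C† R` of the circuit `C`, where `R` is the reflection
about the all-zero ancilla state. -/
noncomputable def grover (c : Circuit b a) : Circuit b a :=
  [reflection] ++ c.dagger ++ [reflection] ++ c ++ [negOne]

/-- Oblivious amplitude amplification `W ^ m C` of the circuit `C`. -/
noncomputable def amplify (m : ℕ) (c : Circuit b a) : Circuit b a :=
  c ++ (List.replicate m (grover c)).flatten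

end Circuit

/-! ### Coupled oscillators -/

/-- A chain of `N` oscillators. The spring `spring j` connects the oscillators `j` and `j + 1`, and
the last spring connects the last and the first oscillator. A constant is `0` if there is no
spring; in particular the last constant is `0` for an open chain. -/
structure OscillatorChain (N : ℕ) where
  mass : Fin N → ℝ
  spring : Fin N → ℝ
  mass_pos : ∀ j, 0 < mass j
  spring_nonneg : ∀ j, 0 ≤ spring j

namespace OscillatorChain

variable {N : ℕ}

/-- The incidence matrix of the chain: column `j` is `e_j - e_{j+1}`, cyclically. -/
def incidence (N : ℕ) : Matrix (Fin N) (Fin N) ℝ :=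
  Matrix.of fun i j =>
    (if i = j then 1 else 0) - (if (i : ℕ) = ((j : ℕ) + 1) % N then 1 else 0)

/-- `B = √M⁻¹ Φ √W`. -/
noncomputable def keyMatrix (c : OscillatorChain N) : Matrix (Fin N) (Fin N) ℝ :=
  Matrix.diagonal (fun i => (Real.sqrt (c.mass i))⁻¹) * incidence N *
    Matrix.diagonal (fun j => Real.sqrt (c.spring j))

/-- The number of index qubits: `⌈log₂ N⌉`. -/
def indexQubits (N : ℕ) : ℕ := Nat.clog 2 N

/-- The matrix `B` as an operator on the index qubits, padded with zero rows and columns. -/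
noncomputable def paddedKeyMatrix (c : OscillatorChain N) :
    Matrix (Reg (Fin (indexQubits N))) (Reg (Fin (indexQubits N))) ℂ :=
  Matrix.of fun x y =>
    if h : (finFunctionFinEquiv x : ℕ) < N ∧ (finFunctionFinEquiv y : ℕ) < N then
      (c.keyMatrix ⟨finFunctionFinEquiv x, h.1⟩ ⟨finFunctionFinEquiv y, h.2⟩ : ℂ)
    else 0

/-- The Hamiltonian `- (|0⟩⟨1| ⊗ B + |1⟩⟨0| ⊗ B†)`; the first qubit selects the block. -/
noncomputable def hamiltonian (c : OscillatorChain N) :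
    Matrix (Reg (Fin (indexQubits N + 1))) (Reg (Fin (indexQubits N + 1))) ℂ :=
  - Matrix.of fun x y =>
    (if x 0 = 0 ∧ y 0 = 1 then c.paddedKeyMatrix (Fin.tail x) (Fin.tail y) else 0) +
    (if x 0 = 1 ∧ y 0 = 0 then c.paddedKeyMatrix.conjTranspose (Fin.tail x) (Fin.tail y) else 0)

/-- The time-evolution operator `exp (- i H t)`. -/
noncomputable def evolution (c : OscillatorChain N) (t : ℝ) :
    Matrix (Reg (Fin (indexQubits N + 1))) (Reg (Fin (indexQubits N + 1))) ℂ :=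
  NormedSpace.exp ((-(Complex.I * t)) • c.hamiltonian)

end OscillatorChain

/-- The signal state (with the flag: ancillas found in `0`) that is produced by the circuit unitary
`C` from the initial state `|0⟩ ⊗ ψ`. -/
noncomputable def outputState {α σ : Type} [Fintype α] [DecidableEq α] [Fintype σ]
    [DecidableEq σ] (C : Matrix (Reg (α ⊕ σ)) (Reg (α ⊕ σ)) ℂ) (ψ : QState σ) : QState σ :=
  flagged (applyOp C (withZeroAncilla ψ))

/-- The normalized state `ψ / ‖ψ‖`. -/
noncomputable def normalized {ι : Type} [Fintype ι] [DecidableEq ι] (ψ : QState ι) : QState ι :=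
  ((‖ψ‖⁻¹ : ℝ) : ℂ) • ψ

/-! ### Operators on some qubits of a register -/

/-! The theorem combines an exact encoding of a truncated exponential series with oblivious
amplitude amplification whose error does not grow with the number of iterations.

Encoding. Let `R` be the reflection about the zero state of the ancillas of `U`, and let `A_j`
alternate between `U` and `U†`. Prefixing the words `R A_j` and `A_j R` acts like multiplying a
polynomial by `1` and by `X` (`signalOp_succ`, `signalOp_succ_X_mul`), and the zero block of their
average is minus the product of the zero blocks (`zeroBlock_signalOp_succ`). Since `H` is Hermitian,
powers of `(X + 1) / 2` therefore encode powers of `H` up to scale, and `X ^ l` pads a short word to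
a longer one. A polynomial of modulus less than one on the unit circle has a complementary
polynomial (Fejér–Riesz, `exists_normSq_eq_of_pos`), and the resulting unit pair is peeled into
one-qubit unitaries, one per call (`IsUnitPair.exists_eq_succ`). The even and odd parts of the
truncated series have different parity, so they are run in superposition on a select qubit. They
share `2 l` uncontrolled calls, and only the last call is controlled. This gives `2 l + 1` calls,
and truncation is the only error (`exists_evolution_circuit`).

Amplification. The zero blocks of `W ^ m C` and `C† W ^ m C` obey a two-term linear recursion. If
the block of `C` is `sin φ` times an isometry, the solution is `sin ((2 m + 1) φ)` and `cos (2 m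
φ)`. If it is so only up to an error `μ`, the deviation obeys the same recursion with forcing of
size `2 μ`. The free recursion preserves a quadratic form (`amplifyEnergy`), so deviations grow only
linearly in `m` (`norm_amplify_sub_le`). Damping the block from `1 / α` to `sin φ`, with `(2 m + 1)
φ = π / 2` and `m = ⌈α⌉`, makes the final amplitude exactly one. Then `μ = δ sin φ` is of order `δ /
m`, which cancels the linear growth. The norm of the initial vector only enlarges the allowed
bounds. -/

theorem eq_extend_of_agree {ι κ : Type} (f : κ ↪ ι) {x y : Reg ι}
    (h : ∀ i, (∀ k, f k ≠ i) → x i = y i) :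
    Function.extend f (fun k => y (f k)) x = y := by
  funext i
  by_cases hi : ∃ k, f k = i
  · obtain ⟨k, rfl⟩ := hi
    rw [f.injective.extend_apply]
  · rw [Function.extend_apply' _ _ _ hi]
    exact h i fun k hk => hi ⟨k, hk⟩

theorem extend_agree {ι κ : Type} (f : κ ↪ ι) (z : Reg κ) (x : Reg ι) (i : ι) (hi : ∀ k, f k ≠ i) :
    Function.extend f z x i = x i :=
  Function.extend_apply' _ _ _ fun ⟨k, hk⟩ => hi k hk

theorem extend_embedding_apply {ι κ : Type} (f : κ ↪ ι) (z : Reg κ) (x : Reg ι) (k : κ) :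
    Function.extend f z x (f k) = z k :=
  f.injective.extend_apply _ _ _

section Registers

variable {ι κ μ : Type} [Fintype ι] [DecidableEq ι] [Fintype κ] [DecidableEq κ]
  [Fintype μ] [DecidableEq μ]

theorem onQubits_apply_of_agree (f : κ ↪ ι) (u : Matrix (Reg κ) (Reg κ) ℂ) {x y : Reg ι}
    (h : ∀ i, (∀ k, f k ≠ i) → x i = y i) :
    onQubits f u x y = u (fun k => x (f k)) (fun k => y (f k)) := by
  rw [onQubits, Matrix.of_apply, if_pos h]

theorem onQubits_apply_of_not_agree (f : κ ↪ ι) (u : Matrix (Reg κ) (Reg κ) ℂ) {x y : Reg ι}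
    (h : ¬ ∀ i, (∀ k, f k ≠ i) → x i = y i) : onQubits f u x y = 0 := by
  rw [onQubits, Matrix.of_apply, if_neg h]

/-- Row `x` is supported on the basis states that agree with `x` off the range of `f`, and
`Function.extend f z x` parametrizes these. Module values let the same formula serve matrix entries
and families of operators. -/
theorem sum_onQubits_smul {E : Type*} [AddCommMonoid E] [Module ℂ E] (f : κ ↪ ι)
    (u : Matrix (Reg κ) (Reg κ) ℂ) (x : Reg ι) (Ψ : Reg ι → E) :
    ∑ y, onQubits f u x y • Ψ y =
      ∑ z, u (fun k => x (f k)) z • Ψ (Function.extend f z x) := by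
  symm
  refine Finset.sum_of_injOn (fun z => Function.extend f z x) ?_ (by simp) ?_ ?_
  · exact (Function.extend_injective f.injective x).injOn
  · intro y _ hy
    rw [onQubits_apply_of_not_agree, zero_smul]
    intro h
    exact hy ⟨fun k => y (f k), by simp, eq_extend_of_agree f h⟩
  · intro z _
    rw [onQubits_apply_of_agree f u fun i hi => (extend_agree f z x i hi).symm]
    simp only [extend_embedding_apply]

theorem onQubits_mul (f : κ ↪ ι) (u v : Matrix (Reg κ) (Reg κ) ℂ) :
    onQubits f (u * v) = onQubits f u * onQubits f v := by
  ext x y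
  rw [Matrix.mul_apply]
  have := sum_onQubits_smul f u x fun z => onQubits f v z y
  simp only [smul_eq_mul] at this
  rw [this]
  by_cases h : ∀ i, (∀ k, f k ≠ i) → x i = y i
  · rw [onQubits_apply_of_agree f _ h, Matrix.mul_apply]
    refine Finset.sum_congr rfl fun z _ => ?_
    rw [onQubits_apply_of_agree f v fun i hi => (extend_agree f z x i hi).trans (h i hi)]
    simp only [extend_embedding_apply]
  · rw [onQubits_apply_of_not_agree f _ h]
    refine (Finset.sum_eq_zero fun z _ => ?_).symm
    rw [onQubits_apply_of_not_agree f v, mul_zero]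
    intro h'
    exact h fun i hi => (extend_agree f z x i hi).symm.trans (h' i hi)

theorem onQubits_one (f : κ ↪ ι) : onQubits f (1 : Matrix (Reg κ) (Reg κ) ℂ) = 1 := by
  ext x y
  by_cases h : ∀ i, (∀ k, f k ≠ i) → x i = y i
  · rw [onQubits_apply_of_agree f _ h, Matrix.one_apply, Matrix.one_apply]
    congr 1
    refine propext ⟨fun hk => ?_, fun hxy => by rw [hxy]⟩
    rw [← eq_extend_of_agree f h, ← hk, eq_extend_of_agree f fun i _ => rfl]
  · rw [onQubits_apply_of_not_agree f _ h, Matrix.one_apply_ne]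
    rintro rfl
    exact h fun _ _ => rfl

theorem onQubits_conjTranspose (f : κ ↪ ι) (u : Matrix (Reg κ) (Reg κ) ℂ) :
    onQubits f u.conjTranspose = (onQubits f u).conjTranspose := by
  ext x y
  rw [Matrix.conjTranspose_apply]
  by_cases h : ∀ i, (∀ k, f k ≠ i) → x i = y i
  · rw [onQubits_apply_of_agree f _ h, onQubits_apply_of_agree f _ fun i hi => (h i hi).symm,
      Matrix.conjTranspose_apply]
  · rw [onQubits_apply_of_not_agree f _ h, onQubits_apply_of_not_agree f _ fun h' =>
      h fun i hi => (h' i hi).symm, star_zero]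

theorem onQubits_trans (f : κ ↪ ι) (g : μ ↪ κ) (u : Matrix (Reg μ) (Reg μ) ℂ) :
    onQubits (g.trans f) u = onQubits f (onQubits g u) := by
  ext x y
  by_cases h : ∀ i, (∀ k, f k ≠ i) → x i = y i
  · rw [onQubits_apply_of_agree f _ h]
    by_cases h' : ∀ j, (∀ k, g k ≠ j) → x (f j) = y (f j)
    · rw [onQubits_apply_of_agree g _ h', onQubits_apply_of_agree]
      · rfl
      · intro i hi
        by_cases hf : ∃ k, f k = i
        · obtain ⟨j, rfl⟩ := hf
          exact h' j fun k hk => hi k (by simp [hk])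
        · exact h i fun k hk => hf ⟨k, hk⟩
    · rw [onQubits_apply_of_not_agree g _ h', onQubits_apply_of_not_agree]
      intro h2
      exact h' fun j hj => h2 (f j) fun k hk => hj k (f.injective hk)
  · rw [onQubits_apply_of_not_agree f _ h, onQubits_apply_of_not_agree]
    intro h2
    exact h fun i hi => h2 i fun k => hi (g k)

theorem onQubits_mem_unitaryGroup (f : κ ↪ ι) {u : Matrix (Reg κ) (Reg κ) ℂ}
    (hu : u ∈ Matrix.unitaryGroup (Reg κ) ℂ) :
    onQubits f u ∈ Matrix.unitaryGroup (Reg ι) ℂ := by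
  rw [Matrix.mem_unitaryGroup_iff, Matrix.star_eq_conjTranspose] at hu ⊢
  rw [← onQubits_conjTranspose, ← onQubits_mul, hu, onQubits_one]

theorem onQubits_diagonal (f : κ ↪ ι) (d : Reg κ → ℂ) :
    onQubits f (Matrix.diagonal d) = Matrix.diagonal fun x => d fun k => x (f k) := by
  ext x y
  by_cases h : ∀ i, (∀ k, f k ≠ i) → x i = y i
  · rw [onQubits_apply_of_agree f _ h]
    by_cases hxy : x = y
    · subst hxy
      simp
    · rw [Matrix.diagonal_apply_ne _ hxy, Matrix.diagonal_apply_ne]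
      intro hk
      apply hxy
      rw [← eq_extend_of_agree f h, ← hk, eq_extend_of_agree f fun i _ => rfl]
  · rw [onQubits_apply_of_not_agree f _ h, Matrix.diagonal_apply_ne]
    rintro rfl
    exact h fun _ _ => rfl

theorem controlledOn_conjTranspose (q : ι) (u : Matrix (Reg ι) (Reg ι) ℂ) :
    controlledOn q u.conjTranspose = (controlledOn q u).conjTranspose := by
  ext x y
  simp only [controlledOn, Matrix.of_apply, Matrix.conjTranspose_apply]
  by_cases h : x q = y q
  · rw [if_pos h, if_pos h.symm, h]
    split_ifs
    · rfl
    · rw [Matrix.one_apply, Matrix.one_apply]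
      by_cases hxy : x = y
      · simp [hxy]
      · simp [hxy, Ne.symm hxy]
  · rw [if_neg h, if_neg fun h' => h h'.symm, star_zero]

theorem controlledOn_onQubits (f : κ ↪ ι) (q : κ) (u : Matrix (Reg κ) (Reg κ) ℂ) :
    controlledOn (f q) (onQubits f u) = onQubits f (controlledOn q u) := by
  ext x y
  by_cases h : ∀ i, (∀ k, f k ≠ i) → x i = y i
  · simp only [controlledOn, Matrix.of_apply]
    rw [onQubits_apply_of_agree f _ h, ← onQubits_one f, onQubits_apply_of_agree f _ h,
      onQubits_apply_of_agree f _ h, Matrix.of_apply]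
  · simp only [controlledOn, Matrix.of_apply]
    rw [onQubits_apply_of_not_agree f _ h, ← onQubits_one f, onQubits_apply_of_not_agree f _ h,
      onQubits_apply_of_not_agree f _ h]
    simp

/-- The left factor must be block diagonal in qubit `q`. Otherwise `u * v` could pass through states
with `q = 0`, which the controlled factors exclude. -/
theorem controlledOn_mul (q : ι) (u v : Matrix (Reg ι) (Reg ι) ℂ)
    (hu : ∀ x y, x q ≠ y q → u x y = 0) :
    controlledOn q (u * v) = controlledOn q u * controlledOn q v := by
  ext x y
  rw [Matrix.mul_apply]
  by_cases hx : x q = 1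
  · by_cases hy : x q = y q
    · simp only [controlledOn, Matrix.of_apply, if_pos hx, if_pos hy, Matrix.mul_apply]
      refine Finset.sum_congr rfl fun z _ => ?_
      by_cases hz : x q = z q
      · rw [if_pos hz, if_pos (hz.symm.trans hy), if_pos (hz.symm.trans hx)]
      · rw [if_neg hz, hu _ _ hz, zero_mul, zero_mul]
    · simp only [controlledOn, Matrix.of_apply, if_neg hy]
      refine (Finset.sum_eq_zero fun z _ => ?_).symm
      by_cases hz : x q = z q
      · rw [if_neg fun h => hy (hz.trans h), mul_zero]
      · rw [if_neg hz, zero_mul]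
  · rw [Finset.sum_eq_single x]
    · simp [controlledOn, hx]
    · intro z _ hz
      simp [controlledOn, hx, hz.symm]
    · simp

theorem controlledOn_one (q : ι) : controlledOn q (1 : Matrix (Reg ι) (Reg ι) ℂ) = 1 := by
  ext x y
  simp only [controlledOn, Matrix.of_apply, ite_self]
  by_cases h : x = y
  · simp [h]
  · simp [h]

theorem controlledOn_onQubits_mem_unitaryGroup (f : κ ↪ ι) {q : ι} (hq : ∀ k, f k ≠ q)
    {u : Matrix (Reg κ) (Reg κ) ℂ} (hu : u ∈ Matrix.unitaryGroup (Reg κ) ℂ) :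
    controlledOn q (onQubits f u) ∈ Matrix.unitaryGroup (Reg ι) ℂ := by
  have h := onQubits_mem_unitaryGroup f hu
  rw [Matrix.mem_unitaryGroup_iff, Matrix.star_eq_conjTranspose] at h ⊢
  rw [← controlledOn_conjTranspose, ← controlledOn_mul, h, controlledOn_one]
  intro x y hxy
  exact onQubits_apply_of_not_agree f u fun h => hxy (h q hq)

theorem diagonal_mem_unitaryGroup {d : Reg ι → ℂ} (hd : ∀ x, d x * star (d x) = 1) :
    Matrix.diagonal d ∈ Matrix.unitaryGroup (Reg ι) ℂ := by
  rw [Matrix.mem_unitaryGroup_iff, Matrix.star_eq_conjTranspose, Matrix.diagonal_conjTranspose,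
    Matrix.diagonal_mul_diagonal, ← Matrix.diagonal_one]
  exact congrArg _ (funext hd)

end Registers

/-! ### Circuits -/

section Circuits

variable {b a s : ℕ} {U : Matrix (Reg (Fin a ⊕ Fin s)) (Reg (Fin a ⊕ Fin s)) ℂ}

theorem callWires_ne (q : Fin b) (k : Fin a ⊕ Fin s) :
    callWires b a s k ≠ Sum.inl (Sum.inl q) := by
  rcases k with k | k <;> simp [callWires]

theorem phase_mul_star (φ : ℝ) :
    Complex.exp (Complex.I * φ) * star (Complex.exp (Complex.I * φ)) = 1 := by
  rw [Complex.star_def, ← Complex.exp_conj, ← Complex.exp_add]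
  simp

theorem Gate.eval_mem_unitaryGroup (hU : U ∈ Matrix.unitaryGroup (Reg (Fin a ⊕ Fin s)) ℂ)
    (g : Gate b a) : g.eval U ∈ Matrix.unitaryGroup (Reg (Wires b a s)) ℂ := by
  have hU' : ∀ inv : Bool, (if inv then U.conjTranspose else U) ∈
      Matrix.unitaryGroup (Reg (Fin a ⊕ Fin s)) ℂ := by
    rintro (_ | _)
    · simpa using hU
    · simpa [Matrix.star_eq_conjTranspose] using Unitary.star_mem hU
  match g with
  | .call none inv => exact onQubits_mem_unitaryGroup _ (hU' inv)
  | .call (some q) inv =>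
    exact controlledOn_onQubits_mem_unitaryGroup _ (callWires_ne q) (hU' inv)
  | .work g => exact onQubits_mem_unitaryGroup _ g.op.2
  | .phase φ p z =>
    refine diagonal_mem_unitaryGroup fun x => ?_
    split_ifs
    · exact phase_mul_star φ
    · simp

theorem Circuit.eval_mem_unitaryGroup (hU : U ∈ Matrix.unitaryGroup (Reg (Fin a ⊕ Fin s)) ℂ)
    (c : Circuit b a) : c.eval U ∈ Matrix.unitaryGroup (Reg (Wires b a s)) ℂ := by
  induction c with
  | nil => exact one_mem _
  | cons g c ih => exact mul_mem ih (g.eval_mem_unitaryGroup hU)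

theorem Circuit.eval_append (c d : Circuit b a) :
    Circuit.eval U (c ++ d) = Circuit.eval U d * Circuit.eval U c := by
  induction c with
  | nil => simp [Circuit.eval]
  | cons g c ih => rw [List.cons_append, Circuit.eval, ih, Circuit.eval, mul_assoc]

theorem Circuit.eval_singleton (g : Gate b a) : Circuit.eval U [g] = g.eval U := by
  simp [Circuit.eval]

theorem Gate.eval_dagger (g : Gate b a) : g.dagger.eval U = (g.eval U).conjTranspose := by
  have hinv : ∀ inv : Bool, (if (!inv) then U.conjTranspose else U) =
      (if inv then U.conjTranspose else U).conjTranspose := by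
    rintro (_ | _) <;> simp
  match g with
  | .call none inv =>
    simp only [Gate.dagger, Gate.eval]
    rw [hinv, onQubits_conjTranspose]
  | .call (some q) inv =>
    simp only [Gate.dagger, Gate.eval]
    rw [hinv, onQubits_conjTranspose, controlledOn_conjTranspose]
  | .work g =>
    simp only [Gate.dagger, Gate.eval, LocalGate.eval]
    rw [← onQubits_conjTranspose]
    rfl
  | .phase φ p z =>
    simp only [Gate.dagger, Gate.eval]
    rw [Matrix.diagonal_conjTranspose]
    congr 1
    funext x
    simp only [Pi.star_apply]
    split_ifs
    · rw [Complex.star_def, ← Complex.exp_conj]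
      simp
    · simp

theorem Circuit.eval_dagger (c : Circuit b a) :
    Circuit.eval U c.dagger = (Circuit.eval U c).conjTranspose := by
  induction c with
  | nil => simp [Circuit.dagger, Circuit.eval]
  | cons g c ih =>
    have : Circuit.dagger (g :: c) = Circuit.dagger c ++ [g.dagger] := by simp [Circuit.dagger]
    rw [this, Circuit.eval_append, Circuit.eval_singleton, ih, Gate.eval_dagger, Circuit.eval,
      Matrix.conjTranspose_mul]

/-- The wires of a circuit inside the register with one more work qubit. -/
def liftWires (b a s : ℕ) : Wires b a s ↪ Wires (b + 1) a s where
  toFun := Sum.map (Sum.map Fin.castSucc id) id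
  inj' := Sum.map_injective.mpr ⟨Sum.map_injective.mpr
    ⟨Fin.castSucc_injective b, Function.injective_id⟩, Function.injective_id⟩

theorem callWires_trans_liftWires :
    (callWires b a s).trans (liftWires b a s) = callWires (b + 1) a s := by
  ext k
  rcases k with k | k <;> rfl

theorem Gate.eval_lift (g : Gate b a) :
    g.lift.eval U = onQubits (liftWires b a s) (g.eval U) := by
  match g with
  | .call none inv =>
    simp only [Gate.lift, Gate.eval, Option.map_none]
    rw [← onQubits_trans, callWires_trans_liftWires]
  | .call (some q) inv =>
    simp only [Gate.lift, Gate.eval, Option.map_some]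
    rw [← controlledOn_onQubits, ← onQubits_trans, callWires_trans_liftWires]
    rfl
  | .work g =>
    simp only [Gate.lift, Gate.eval, LocalGate.eval]
    rw [← onQubits_trans]
    rfl
  | .phase φ p z =>
    simp only [Gate.lift, Gate.eval]
    rw [onQubits_diagonal]
    congr 1
    funext x
    congr 1
    refine propext (and_congr ?_ Iff.rfl)
    constructor
    · intro h q v hq
      exact h q.castSucc v (by simpa using hq)
    · intro h q v
      refine Fin.lastCases (fun hq => ?_) (fun q hq => ?_) q
      · simp at hq
      · exact h q v (by simpa using hq)

theorem Circuit.eval_map_lift (c : Circuit b a) :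
    Circuit.eval U (c.map Gate.lift) = onQubits (liftWires b a s) (Circuit.eval U c) := by
  induction c with
  | nil => simp [Circuit.eval, onQubits_one]
  | cons g c ih => rw [List.map_cons, Circuit.eval, ih, Gate.eval_lift, Circuit.eval, onQubits_mul]

theorem sum_elim_zero_comp_liftWires (x : Reg (Fin s)) :
    (fun k => (Sum.elim (fun _ => 0) x : Reg (Wires (b + 1) a s)) (liftWires b a s k)) =
      Sum.elim (fun _ => 0) x := by
  funext k
  rcases k with k | k <;> rfl

/-- The lifted operator leaves the new qubit alone, so only the entry `⟨0|·|0⟩ = cos θ` of the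
rotation reaches the zero block. -/
theorem zeroBlock_rotation_mul (θ : ℝ) (f : Fin 1 ↪ Wires (b + 1) a s)
    (hf : ∀ k, f k = Sum.inl (Sum.inl (Fin.last b)))
    (M : Matrix (Reg (Wires b a s)) (Reg (Wires b a s)) ℂ) :
    zeroBlock (onQubits f (Circuit.rotation θ) * onQubits (liftWires b a s) M) =
      (Real.cos θ : ℂ) • zeroBlock M := by
  ext x y
  simp only [zeroBlock, Matrix.of_apply, Matrix.smul_apply]
  rw [Matrix.mul_apply]
  have := sum_onQubits_smul f (Circuit.rotation θ)
    (Sum.elim (fun _ => 0) x : Reg (Wires (b + 1) a s)) fun z =>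
      onQubits (liftWires b a s) M z (Sum.elim (fun _ => 0) y)
  simp only [smul_eq_mul] at this
  refine this.trans ?_
  rw [Finset.sum_eq_single (fun _ => 0)]
  · have hx : Function.extend f (fun _ => 0) (Sum.elim (fun _ => 0) x : Reg (Wires (b + 1) a s)) =
        Sum.elim (fun _ => 0) x := by
      funext i
      by_cases hi : ∃ k, f k = i
      · obtain ⟨k, rfl⟩ := hi
        rw [extend_embedding_apply, hf]
        rfl
      · exact Function.extend_apply' _ _ _ hi
    rw [hx, onQubits_apply_of_agree]
    · rw [sum_elim_zero_comp_liftWires, sum_elim_zero_comp_liftWires]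
      simp [Circuit.rotation, hf]
    · rintro ((i | i) | i) hi
      · rfl
      · rfl
      · exact absurd rfl (hi (Sum.inr i))
  · intro z _ hz
    rw [onQubits_apply_of_not_agree, mul_zero]
    intro h
    apply hz
    funext k
    have h1 := h (f k) fun j hj => ?_
    · rw [extend_embedding_apply, hf] at h1
      exact h1
    · rw [hf] at hj
      rcases j with (j | j) | j
      · exact Fin.castSucc_ne_last j (Sum.inl_injective (Sum.inl_injective hj))
      · exact Sum.inr_ne_inl (Sum.inl_injective hj)
      · exact Sum.inr_ne_inl hj
  · simp

theorem Circuit.zeroBlock_eval_damp (θ : ℝ) (c : Circuit b a) :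
    zeroBlock (Circuit.eval U (c.damp θ)) = (Real.cos θ : ℂ) • zeroBlock (Circuit.eval U c) := by
  rw [Circuit.damp, Circuit.eval_append, Circuit.eval_singleton, Circuit.eval_map_lift]
  exact zeroBlock_rotation_mul θ _ (fun _ => rfl) _

theorem Gate.isCall_dagger (g : Gate b a) : g.dagger.isCall = g.isCall := by
  cases g <;> rfl

theorem Gate.isCall_lift (g : Gate b a) : g.lift.isCall = g.isCall := by
  cases g <;> rfl

theorem Circuit.calls_append (c d : Circuit b a) :
    Circuit.calls (c ++ d) = Circuit.calls c + Circuit.calls d := by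
  simp [Circuit.calls]

theorem Circuit.otherGates_append (c d : Circuit b a) :
    Circuit.otherGates (c ++ d) = Circuit.otherGates c + Circuit.otherGates d := by
  simp [Circuit.otherGates]

theorem Circuit.calls_dagger (c : Circuit b a) : c.dagger.calls = c.calls := by
  simp only [Circuit.calls, Circuit.dagger, List.countP_reverse, List.countP_map]
  congr 1
  funext g
  exact g.isCall_dagger

theorem Circuit.otherGates_dagger (c : Circuit b a) : c.dagger.otherGates = c.otherGates := by
  simp only [Circuit.otherGates, Circuit.dagger, List.countP_reverse, List.countP_map]
  congr 1
  funext g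
  exact congrArg _ g.isCall_dagger

theorem Circuit.calls_damp (θ : ℝ) (c : Circuit b a) : (c.damp θ).calls = c.calls := by
  rw [Circuit.damp, Circuit.calls_append]
  simp only [Circuit.calls, List.countP_map]
  rw [show (fun g : Gate (b + 1) a => g.isCall) ∘ Gate.lift = fun g : Gate b a => g.isCall from
    funext Gate.isCall_lift]
  simp [Gate.isCall]

theorem Circuit.otherGates_damp (θ : ℝ) (c : Circuit b a) :
    (c.damp θ).otherGates = c.otherGates + 1 := by
  rw [Circuit.damp, Circuit.otherGates_append]
  simp only [Circuit.otherGates, List.countP_map]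
  rw [show (fun g : Gate (b + 1) a => !g.isCall) ∘ Gate.lift = fun g : Gate b a => !g.isCall from
    funext fun g => congrArg _ g.isCall_lift]
  simp [Gate.isCall]

theorem Circuit.amplify_succ (m : ℕ) (c : Circuit b a) :
    c.amplify (m + 1) = c.amplify m ++ c.grover := by
  simp [Circuit.amplify, List.replicate_succ', List.flatten_append]

theorem Circuit.calls_amplify (m : ℕ) (c : Circuit b a) :
    (c.amplify m).calls = (2 * m + 1) * c.calls := by
  induction m with
  | zero => simp [Circuit.amplify]
  | succ m ih =>
    have : (Circuit.grover c).calls = 2 * c.calls := by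
      simp only [Circuit.grover, Circuit.calls_append, Circuit.calls_dagger]
      simp [Circuit.calls, Circuit.reflection, Circuit.negOne, Gate.isCall]
      ring
    rw [Circuit.amplify_succ, Circuit.calls_append, ih, this]
    ring

theorem Circuit.otherGates_amplify (m : ℕ) (c : Circuit b a) :
    (c.amplify m).otherGates = (2 * m + 1) * c.otherGates + 3 * m := by
  induction m with
  | zero => simp [Circuit.amplify]
  | succ m ih =>
    have : (Circuit.grover c).otherGates = 2 * c.otherGates + 3 := by
      simp only [Circuit.grover, Circuit.otherGates_append, Circuit.otherGates_dagger]
      simp [Circuit.otherGates, Circuit.reflection, Circuit.negOne, Gate.isCall]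
      ring
    rw [Circuit.amplify_succ, Circuit.otherGates_append, ih, this]
    ring

end Circuits

/-! ### Blocks of operators on ancilla and signal qubits -/

section Blocks

/-- The projector `|0⟩⟨0| ⊗ I` onto the all-zero state of the ancilla qubits. -/
noncomputable def zeroProj (α σ : Type) [Fintype α] [DecidableEq α] [Fintype σ] [DecidableEq σ] :
    Matrix (Reg (α ⊕ σ)) (Reg (α ⊕ σ)) ℂ :=
  Matrix.diagonal fun x => if ∀ i, x (Sum.inl i) = 0 then 1 else 0

/-- The reflection `I - 2 |0⟩⟨0| ⊗ I`. -/
noncomputable def zeroReflection (α σ : Type) [Fintype α] [DecidableEq α] [Fintype σ]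
    [DecidableEq σ] : Matrix (Reg (α ⊕ σ)) (Reg (α ⊕ σ)) ℂ :=
  1 - (2 : ℂ) • zeroProj α σ

variable {α σ : Type}

theorem zeroBlock_add (M N : Matrix (Reg (α ⊕ σ)) (Reg (α ⊕ σ)) ℂ) :
    zeroBlock (M + N) = zeroBlock M + zeroBlock N := rfl

theorem zeroBlock_sub (M N : Matrix (Reg (α ⊕ σ)) (Reg (α ⊕ σ)) ℂ) :
    zeroBlock (M - N) = zeroBlock M - zeroBlock N := rfl

theorem zeroBlock_neg (M : Matrix (Reg (α ⊕ σ)) (Reg (α ⊕ σ)) ℂ) :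
    zeroBlock (-M) = -zeroBlock M := rfl

theorem zeroBlock_smul (c : ℂ) (M : Matrix (Reg (α ⊕ σ)) (Reg (α ⊕ σ)) ℂ) :
    zeroBlock (c • M) = c • zeroBlock M := rfl

theorem zeroBlock_conjTranspose (M : Matrix (Reg (α ⊕ σ)) (Reg (α ⊕ σ)) ℂ) :
    zeroBlock M.conjTranspose = (zeroBlock M).conjTranspose := rfl

theorem zeroBlock_sum {ι : Type*} (t : Finset ι)
    (M : ι → Matrix (Reg (α ⊕ σ)) (Reg (α ⊕ σ)) ℂ) :
    zeroBlock (∑ i ∈ t, M i) = ∑ i ∈ t, zeroBlock (M i) := by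
  ext x y
  simp [zeroBlock, Matrix.sum_apply]

variable [Fintype α] [Fintype σ]

theorem zeroBlock_one : zeroBlock (1 : Matrix (Reg (α ⊕ σ)) (Reg (α ⊕ σ)) ℂ) = 1 := by
  ext x y
  simp only [zeroBlock, Matrix.of_apply, Matrix.one_apply]
  congr 1
  refine propext ⟨fun h => ?_, fun h => by rw [h]⟩
  funext j
  exact congrFun h (Sum.inr j)

variable [DecidableEq α] [DecidableEq σ]

theorem sum_zero_ancilla {E : Type*} [AddCommMonoid E] (f : Reg (α ⊕ σ) → E) :
    ∑ x, (if ∀ i, x (Sum.inl i) = 0 then f x else 0) =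
      ∑ y : Reg σ, f (Sum.elim (fun _ => 0) y) := by
  symm
  refine Finset.sum_of_injOn (fun y => Sum.elim (fun _ => 0) y) ?_ (by simp) ?_ ?_
  · intro y _ z _ h
    funext j
    exact congrFun h (Sum.inr j)
  · intro x _ hx
    rw [if_neg]
    intro h
    refine hx ⟨fun j => x (Sum.inr j), by simp, ?_⟩
    funext k
    rcases k with k | k
    · exact (h k).symm
    · rfl
  · intro y _
    simp

/-- Compression to a block is multiplicative exactly when the projector stands between the factors.
All block recursions below come from this by expanding `R = 1 - 2 Π`. -/
theorem zeroBlock_mul_zeroProj_mul (M N : Matrix (Reg (α ⊕ σ)) (Reg (α ⊕ σ)) ℂ) :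
    zeroBlock (M * zeroProj α σ * N) = zeroBlock M * zeroBlock N := by
  ext x y
  rw [Matrix.mul_apply, zeroBlock, Matrix.of_apply, Matrix.mul_apply]
  simp only [zeroBlock, Matrix.of_apply, zeroProj, Matrix.mul_diagonal]
  rw [← sum_zero_ancilla fun z => M (Sum.elim (fun _ => 0) x) z * N z (Sum.elim (fun _ => 0) y)]
  refine Finset.sum_congr rfl fun z _ => ?_
  split_ifs <;> simp

theorem zeroBlock_mul_zeroReflection_mul (M N : Matrix (Reg (α ⊕ σ)) (Reg (α ⊕ σ)) ℂ) :
    zeroBlock (M * zeroReflection α σ * N) =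
      zeroBlock (M * N) - (2 : ℂ) • (zeroBlock M * zeroBlock N) := by
  rw [zeroReflection, mul_sub, sub_mul, mul_one, Matrix.mul_smul, Matrix.smul_mul, zeroBlock_sub,
    zeroBlock_smul, zeroBlock_mul_zeroProj_mul]

theorem zeroBlock_zeroReflection_mul (M : Matrix (Reg (α ⊕ σ)) (Reg (α ⊕ σ)) ℂ) :
    zeroBlock (zeroReflection α σ * M) = -zeroBlock M := by
  have := zeroBlock_mul_zeroReflection_mul 1 M
  rw [one_mul, one_mul, zeroBlock_one, one_mul] at this
  rw [this, two_smul]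
  abel

theorem zeroProj_mul_self : zeroProj α σ * zeroProj α σ = zeroProj α σ := by
  rw [zeroProj, Matrix.diagonal_mul_diagonal]
  congr 1
  funext x
  split_ifs <;> simp

theorem zeroReflection_mul_self : zeroReflection α σ * zeroReflection α σ = 1 := by
  rw [zeroReflection, sub_mul, mul_sub, mul_sub, Matrix.smul_mul, Matrix.smul_mul,
    Matrix.mul_smul, Matrix.mul_smul, zeroProj_mul_self]
  simp only [mul_one, one_mul]
  module

theorem zeroReflection_eq_diagonal :
    zeroReflection α σ = Matrix.diagonal fun x => if ∀ i, x (Sum.inl i) = 0 then -1 else 1 := by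
  rw [zeroReflection, zeroProj, ← Matrix.diagonal_one, ← Matrix.diagonal_smul,
    Matrix.diagonal_sub]
  congr 1
  funext x
  simp only [Pi.smul_apply]
  split_ifs <;> norm_num

theorem outputState_eq (C : Matrix (Reg (α ⊕ σ)) (Reg (α ⊕ σ)) ℂ) (ψ : QState σ) :
    outputState C ψ = applyOp (zeroBlock C) ψ := by
  ext x
  simp only [outputState, flagged, applyOp, Matrix.ofLp_toEuclideanCLM, withZeroAncilla,
    Matrix.mulVec, dotProduct, zeroBlock, Matrix.of_apply]
  refine Eq.trans ?_ (sum_zero_ancilla fun z =>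
    C (Sum.elim (fun _ => 0) x) z * ψ fun j => z (Sum.inr j))
  refine Finset.sum_congr rfl fun z _ => ?_
  split_ifs <;> simp

theorem norm_withZeroAncilla (ψ : QState σ) :
    ‖(withZeroAncilla ψ : QState (α ⊕ σ))‖ = ‖ψ‖ := by
  rw [EuclideanSpace.norm_eq, EuclideanSpace.norm_eq]
  congr 1
  refine Eq.trans ?_ (sum_zero_ancilla fun z : Reg (α ⊕ σ) => ‖ψ fun j => z (Sum.inr j)‖ ^ 2)
  refine Finset.sum_congr rfl fun z _ => ?_
  simp only [withZeroAncilla]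
  split_ifs <;> simp

theorem norm_flagged_le (φ : QState (α ⊕ σ)) : ‖flagged φ‖ ≤ ‖φ‖ := by
  rw [EuclideanSpace.norm_eq, EuclideanSpace.norm_eq]
  apply Real.sqrt_le_sqrt
  simp only [flagged]
  rw [← sum_zero_ancilla (fun z : Reg (α ⊕ σ) => ‖φ z‖ ^ 2)]
  refine Finset.sum_le_sum fun z _ => ?_
  split_ifs
  · exact le_rfl
  · positivity

theorem norm_applyOp_of_mem_unitaryGroup {ι : Type} [Fintype ι] [DecidableEq ι]
    {V : Matrix (Reg ι) (Reg ι) ℂ} (hV : V ∈ Matrix.unitaryGroup (Reg ι) ℂ) (ψ : QState ι) :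
    ‖applyOp V ψ‖ = ‖ψ‖ := by
  have h : Matrix.toEuclideanCLM (𝕜 := ℂ) V ∈ unitary (QState ι →L[ℂ] QState ι) := by
    rw [Unitary.mem_iff, ← map_star, ← map_mul, ← map_mul]
    rw [Matrix.mem_unitaryGroup_iff'.mp hV, Matrix.mem_unitaryGroup_iff.mp hV]
    simp
  exact ContinuousLinearMap.norm_map_of_mem_unitary h ψ

theorem norm_applyOp_le {ι : Type} [Fintype ι] [DecidableEq ι] (A : Matrix (Reg ι) (Reg ι) ℂ)
    (ψ : QState ι) : ‖applyOp A ψ‖ ≤ specNorm A * ‖ψ‖ :=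
  ContinuousLinearMap.le_opNorm _ _

theorem specNorm_zeroBlock_le_one {C : Matrix (Reg (α ⊕ σ)) (Reg (α ⊕ σ)) ℂ}
    (hC : C ∈ Matrix.unitaryGroup (Reg (α ⊕ σ)) ℂ) : specNorm (zeroBlock C) ≤ 1 := by
  refine ContinuousLinearMap.opNorm_le_bound _ zero_le_one fun ψ => ?_
  have h := outputState_eq C ψ
  rw [applyOp] at h
  rw [← h, one_mul, outputState]
  refine (norm_flagged_le _).trans ?_
  rw [norm_applyOp_of_mem_unitaryGroup hC, norm_withZeroAncilla]

end Blocks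

/-! ### Oblivious amplitude amplification -/

section Amplification

theorem Circuit.eval_reflection {b a s : ℕ}
    (U : Matrix (Reg (Fin a ⊕ Fin s)) (Reg (Fin a ⊕ Fin s)) ℂ) :
    (Circuit.reflection : Gate b a).eval U = zeroReflection (Fin b ⊕ Fin a) (Fin s) := by
  rw [zeroReflection_eq_diagonal]
  simp only [Circuit.reflection, Gate.eval]
  congr 1
  funext x
  congr 1
  · simp
  · rw [mul_comm, Complex.exp_pi_mul_I]

theorem Circuit.eval_negOne {b a s : ℕ}
    (U : Matrix (Reg (Fin a ⊕ Fin s)) (Reg (Fin a ⊕ Fin s)) ℂ) :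
    (Circuit.negOne : Gate b a).eval U = -1 := by
  simp only [Circuit.negOne, Gate.eval]
  rw [← Matrix.diagonal_one, Matrix.diagonal_neg]
  congr 1
  funext x
  rw [if_pos (by simp), mul_comm, Complex.exp_pi_mul_I]

variable {b a s : ℕ} {U : Matrix (Reg (Fin a ⊕ Fin s)) (Reg (Fin a ⊕ Fin s)) ℂ}

theorem Circuit.eval_grover (c : Circuit b a) :
    Circuit.eval U c.grover = -(Circuit.eval U c * zeroReflection (Fin b ⊕ Fin a) (Fin s) *
      (Circuit.eval U c).conjTranspose * zeroReflection (Fin b ⊕ Fin a) (Fin s)) := by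
  simp only [Circuit.grover, Circuit.eval_append, Circuit.eval_singleton, Circuit.eval_reflection,
    Circuit.eval_negOne, Circuit.eval_dagger]
  simp [mul_assoc]

/-- The even companion of the amplified blocks. -/
noncomputable def Circuit.amplifyAux
    (U : Matrix (Reg (Fin a ⊕ Fin s)) (Reg (Fin a ⊕ Fin s)) ℂ) (c : Circuit b a) (m : ℕ) :
    Matrix (Reg (Fin s)) (Reg (Fin s)) ℂ :=
  zeroBlock ((Circuit.eval U c).conjTranspose * Circuit.eval U (c.amplify m))

theorem Circuit.amplifyAux_zero (hU : U ∈ Matrix.unitaryGroup (Reg (Fin a ⊕ Fin s)) ℂ)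
    (c : Circuit b a) : Circuit.amplifyAux U c 0 = 1 := by
  have h := Matrix.mem_unitaryGroup_iff'.mp (Circuit.eval_mem_unitaryGroup hU c)
  rw [Matrix.star_eq_conjTranspose] at h
  rw [Circuit.amplifyAux]
  simp [Circuit.amplify, h, zeroBlock_one]

/-- In `C† (-C R C† R)` the factor `C† C` cancels. The leading `-R` is then the identity on the zero
block, and expanding the remaining `R` gives the two terms. -/
theorem Circuit.amplifyAux_succ (hU : U ∈ Matrix.unitaryGroup (Reg (Fin a ⊕ Fin s)) ℂ)
    (c : Circuit b a) (m : ℕ) :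
    Circuit.amplifyAux U c (m + 1) = Circuit.amplifyAux U c m -
      (2 : ℂ) • ((zeroBlock (Circuit.eval U c)).conjTranspose *
        zeroBlock (Circuit.eval U (c.amplify m))) := by
  have h := Matrix.mem_unitaryGroup_iff'.mp (Circuit.eval_mem_unitaryGroup hU c)
  rw [Matrix.star_eq_conjTranspose] at h
  rw [Circuit.amplifyAux, Circuit.amplify_succ, Circuit.eval_append, Circuit.eval_grover,
    ← zeroBlock_conjTranspose, Circuit.amplifyAux, ← zeroBlock_mul_zeroReflection_mul,
    ← neg_neg (zeroBlock (_ * _ * _)), ← zeroBlock_zeroReflection_mul, ← zeroBlock_neg]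
  congr 1
  simp only [mul_assoc, neg_mul, mul_neg, neg_inj]
  rw [← mul_assoc (Circuit.eval U c).conjTranspose, h, one_mul]

/-- Expand the reflection behind the leading `C`. In one term `C C†` cancels and leaves a sign, and
in the other the block of `C† R W ^ m C` is the auxiliary block at `m + 1`. -/
theorem Circuit.zeroBlock_amplify_succ (hU : U ∈ Matrix.unitaryGroup (Reg (Fin a ⊕ Fin s)) ℂ)
    (c : Circuit b a) (m : ℕ) :
    zeroBlock (Circuit.eval U (c.amplify (m + 1))) = zeroBlock (Circuit.eval U (c.amplify m)) +
      (2 : ℂ) • (zeroBlock (Circuit.eval U c) * Circuit.amplifyAux U c (m + 1)) := by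
  have h := Matrix.mem_unitaryGroup_iff'.mp (Circuit.eval_mem_unitaryGroup hU c)
  have h' := Matrix.mem_unitaryGroup_iff.mp (Circuit.eval_mem_unitaryGroup hU c)
  rw [Matrix.star_eq_conjTranspose] at h h'
  have key := zeroBlock_mul_zeroReflection_mul (Circuit.eval U c)
    ((Circuit.eval U c).conjTranspose * zeroReflection _ _ * Circuit.eval U (c.amplify m))
  have e1 : Circuit.eval U c * ((Circuit.eval U c).conjTranspose * zeroReflection _ _ *
      Circuit.eval U (c.amplify m)) = zeroReflection _ _ * Circuit.eval U (c.amplify m) := by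
    rw [← mul_assoc, ← mul_assoc, h', one_mul]
  have e2 : Circuit.amplifyAux U c (m + 1) = zeroBlock ((Circuit.eval U c).conjTranspose *
      zeroReflection _ _ * Circuit.eval U (c.amplify m)) := by
    rw [Circuit.amplifyAux_succ hU, zeroBlock_mul_zeroReflection_mul, Circuit.amplifyAux,
      zeroBlock_conjTranspose]
  rw [e1, zeroBlock_zeroReflection_mul] at key
  rw [e2, Circuit.amplify_succ, Circuit.eval_append, Circuit.eval_grover, neg_mul, zeroBlock_neg]
  have e3 : Circuit.eval U c * zeroReflection _ _ * (Circuit.eval U c).conjTranspose *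
      zeroReflection _ _ * Circuit.eval U (c.amplify m) = Circuit.eval U c * zeroReflection _ _ *
        ((Circuit.eval U c).conjTranspose * zeroReflection _ _ *
          Circuit.eval U (c.amplify m)) := by
    simp only [mul_assoc]
  rw [e3, key]
  abel

end Amplification

/-! ### Stability of the amplification recursion -/

section Stability

open ContinuousLinearMap

variable {F : Type*} [NormedAddCommGroup F] [InnerProductSpace ℂ F]

/-- The quadratic form that is preserved by the steps of the amplification recursion. -/
noncomputable def amplifyEnergy (A : F →L[ℂ] F) (x y : F) : ℝ :=
  ‖x‖ ^ 2 + ‖y‖ ^ 2 - 2 * RCLike.re (inner ℂ y (A x))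

theorem amplifyEnergy_eq_left (A : F →L[ℂ] F) (x y : F) :
    amplifyEnergy A x y = ‖y - A x‖ ^ 2 + (‖x‖ ^ 2 - ‖A x‖ ^ 2) := by
  rw [amplifyEnergy, @norm_sub_sq ℂ]
  ring

/-- The triangle inequality for `√(p² + g)` when only `p` is perturbed. -/
theorem add_sq_le_of_add_sq_le {E μ p q g : ℝ} (hE : 0 ≤ E) (hμ : 0 ≤ μ) (hg : 0 ≤ g)
    (h : p ^ 2 + g ≤ E ^ 2) (hq : q ≤ p + μ) (hq0 : 0 ≤ q) : q ^ 2 + g ≤ (E + μ) ^ 2 := by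
  have hp : p ≤ E := abs_le_of_sq_le_sq' (by linarith) hE |>.2
  nlinarith [pow_le_pow_left₀ hq0 hq 2, mul_le_mul_of_nonneg_right hp hμ]

/-- After completing the square in `y`, the unforced step turns `y + A x` into the same vector
written as `y' - A x`, so the form for `-A` passes into the form for `A` unchanged. The forcing
moves only this square. `amplifyEnergy_step_left` does the same in `x` and returns from `A` to `-A`.
-/
theorem amplifyEnergy_step_right {A : F →L[ℂ] F} (hA : ‖A‖ ≤ 1) {x y f : F} {E μ : ℝ}
    (hE : 0 ≤ E) (h : amplifyEnergy (-A) x y ≤ E ^ 2) (hf : ‖f‖ ≤ μ) :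
    amplifyEnergy A x (y + (2 : ℂ) • A x + f) ≤ (E + μ) ^ 2 := by
  rw [amplifyEnergy_eq_left] at h ⊢
  have e : y + (2 : ℂ) • A x + f - A x = y - (-A) x + f := by
    rw [neg_apply]
    module
  have hx : ‖A x‖ ≤ ‖x‖ := (A.le_opNorm x).trans (by nlinarith [norm_nonneg x])
  rw [neg_apply, norm_neg] at h
  rw [e, neg_apply]
  exact add_sq_le_of_add_sq_le hE ((norm_nonneg _).trans hf)
    (by nlinarith [norm_nonneg (A x)]) h
    ((norm_add_le _ f).trans (by linarith)) (norm_nonneg _)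

variable [CompleteSpace F]

theorem amplifyEnergy_eq_right (A : F →L[ℂ] F) (x y : F) :
    amplifyEnergy A x y = ‖x - adjoint A y‖ ^ 2 + (‖y‖ ^ 2 - ‖adjoint A y‖ ^ 2) := by
  rw [amplifyEnergy, @norm_sub_sq ℂ, adjoint_inner_right, inner_re_symm]
  ring

theorem amplifyEnergy_step_left {A : F →L[ℂ] F} (hA : ‖A‖ ≤ 1) {x y f : F} {E μ : ℝ}
    (hE : 0 ≤ E) (h : amplifyEnergy A x y ≤ E ^ 2) (hf : ‖f‖ ≤ μ) :
    amplifyEnergy (-A) (x - (2 : ℂ) • adjoint A y + f) y ≤ (E + μ) ^ 2 := by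
  rw [amplifyEnergy_eq_right] at h ⊢
  have e : x - (2 : ℂ) • adjoint A y + f - adjoint (-A) y = x - adjoint A y + f := by
    rw [map_neg, neg_apply]
    module
  have hy : ‖adjoint A y‖ ≤ ‖y‖ := ((adjoint A).le_opNorm y).trans (by
    rw [LinearIsometryEquiv.norm_map]
    nlinarith [norm_nonneg y])
  rw [e, map_neg, neg_apply, norm_neg]
  exact add_sq_le_of_add_sq_le hE ((norm_nonneg _).trans hf)
    (by nlinarith [norm_nonneg (adjoint A y)]) h
    ((norm_add_le _ f).trans (by linarith)) (norm_nonneg _)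

/-- The recursion of oblivious amplitude amplification for a block `A` that is close to a multiple
of an isometry `E`. -/
theorem norm_amplify_sub_le {A E : F →L[ℂ] F} {φ μ c : ℝ} (hE : adjoint E * E = 1)
    (hnorm : ‖E‖ ≤ 1) (hμ : ‖A - (Real.sin φ : ℂ) • E‖ ≤ μ) (hAc : ‖A‖ ≤ c) (hc : c < 1)
    {ψ : F} (hψ : ‖ψ‖ ≤ 1) {x y : ℕ → F} (hx0 : x 0 = ψ) (hy0 : y 0 = A ψ)
    (hx : ∀ m, x (m + 1) = x m - (2 : ℂ) • adjoint A (y m))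
    (hy : ∀ m, y (m + 1) = y m + (2 : ℂ) • A (x (m + 1))) (m : ℕ) :
    (1 - c ^ 2) * ‖y m - (Real.sin ((2 * m + 1) * φ) : ℂ) • E ψ‖ ^ 2 ≤
      ((4 * m + 1) * μ) ^ 2 := by
  have hA1 : ‖A‖ ≤ 1 := hAc.trans hc.le
  have hμ0 : 0 ≤ μ := (norm_nonneg _).trans hμ
  have hEψ : ‖E ψ‖ ≤ 1 := (E.le_opNorm ψ).trans
    (mul_le_one₀ hnorm (norm_nonneg _) hψ)
  have hEE : adjoint E (E ψ) = ψ := congrArg (fun T : F →L[ℂ] F => T ψ) hE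
  set Δ : F →L[ℂ] F := A - (Real.sin φ : ℂ) • E with hΔ
  have hΔad : adjoint A = adjoint Δ + (Real.sin φ : ℂ) • adjoint E := by
    rw [hΔ, map_sub, LinearIsometryEquiv.map_smulₛₗ, Complex.conj_ofReal]
    abel
  have hAΔ : A = Δ + (Real.sin φ : ℂ) • E := by rw [hΔ]; abel
  have hforce : ∀ (T : F →L[ℂ] F) (r : ℝ) (v : F), ‖T‖ ≤ μ → |r| ≤ 1 → ‖v‖ ≤ 1 →
      ‖(2 : ℂ) • T ((r : ℂ) • v)‖ ≤ 2 * μ := by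
    intro T r v hT hr hv
    rw [norm_smul, map_smul, norm_smul, Complex.norm_real, Real.norm_eq_abs]
    have h1 : ‖T v‖ ≤ μ := (T.le_opNorm v).trans (by nlinarith [norm_nonneg v])
    have h2 : |r| * ‖T v‖ ≤ 1 * μ := mul_le_mul hr h1 (norm_nonneg _) zero_le_one
    norm_num
    linarith
  have trig1 : ∀ m : ℕ, Real.cos (2 * (m + 1 : ℕ) * φ) = Real.cos (2 * m * φ) -
      2 * Real.sin φ * Real.sin ((2 * m + 1) * φ) := by
    intro m
    have e1 : (2 * (m + 1 : ℕ) * φ : ℝ) = (2 * m + 1) * φ + φ := by push_cast; ring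
    have e2 : (2 * m * φ : ℝ) = (2 * m + 1) * φ - φ := by ring
    rw [e1, e2, Real.cos_add, Real.cos_sub]
    ring
  have trig2 : ∀ m : ℕ, Real.sin ((2 * (m + 1 : ℕ) + 1) * φ) = Real.sin ((2 * m + 1) * φ) +
      2 * Real.sin φ * Real.cos (2 * (m + 1 : ℕ) * φ) := by
    intro m
    have e1 : ((2 * (m + 1 : ℕ) + 1) * φ : ℝ) = 2 * (m + 1 : ℕ) * φ + φ := by push_cast; ring
    have e2 : ((2 * m + 1) * φ : ℝ) = 2 * (m + 1 : ℕ) * φ - φ := by push_cast; ring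
    rw [e1, e2, Real.sin_add, Real.sin_sub]
    ring
  -- The deviation from the ideal solution follows the recursion of the true `A`, forced by `A - sin
  -- φ • E` acting on the ideal solution. It starts at `μ`, and two half-steps of `2 μ` each add `4
  -- μ` per iteration.
  have key : ∀ m : ℕ, amplifyEnergy A (x m - (Real.cos (2 * m * φ) : ℂ) • ψ)
      (y m - (Real.sin ((2 * m + 1) * φ) : ℂ) • E ψ) ≤ ((4 * m + 1) * μ) ^ 2 := by
    intro m
    induction m with
    | zero =>
      rw [amplifyEnergy, hx0, hy0]
      simp only [Nat.cast_zero, mul_zero, zero_mul, Real.cos_zero, Complex.ofReal_one, one_smul,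
        sub_self, zero_add, one_mul, norm_zero, map_zero, inner_zero_right, sub_zero]
      have : ‖Δ ψ‖ ≤ μ := (Δ.le_opNorm ψ).trans (by nlinarith [norm_nonneg ψ])
      have e : A ψ - (Real.sin φ : ℂ) • E ψ = Δ ψ := by simp [hΔ]
      rw [e]
      nlinarith [norm_nonneg (Δ ψ)]
    | succ m ih =>
      have h1 := amplifyEnergy_step_left hA1 (by positivity) ih
        (f := -((2 : ℂ) • adjoint Δ ((Real.sin ((2 * m + 1) * φ) : ℂ) • E ψ))) (μ := 2 * μ)
        (by
          rw [norm_neg]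
          exact hforce _ _ _ (by rwa [LinearIsometryEquiv.norm_map]) (Real.abs_sin_le_one _) hEψ)
      have e1 : x m - (Real.cos (2 * m * φ) : ℂ) • ψ - (2 : ℂ) • adjoint A
          (y m - (Real.sin ((2 * m + 1) * φ) : ℂ) • E ψ) +
          -((2 : ℂ) • adjoint Δ ((Real.sin ((2 * m + 1) * φ) : ℂ) • E ψ)) =
          x (m + 1) - (Real.cos (2 * (m + 1 : ℕ) * φ) : ℂ) • ψ := by
        have hexp : adjoint A ((Real.sin ((2 * m + 1) * φ) : ℂ) • E ψ) =
            adjoint Δ ((Real.sin ((2 * m + 1) * φ) : ℂ) • E ψ) +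
              ((Real.sin φ : ℂ) * (Real.sin ((2 * m + 1) * φ) : ℂ)) • ψ := by
          rw [hΔad, add_apply, smul_apply, map_smul (adjoint E), hEE, smul_smul]
        rw [hx, trig1, map_sub, hexp, Complex.ofReal_sub, Complex.ofReal_mul, Complex.ofReal_mul]
        push_cast
        module
      rw [e1] at h1
      have h2 := amplifyEnergy_step_right hA1 (by positivity) h1
        (f := (2 : ℂ) • Δ ((Real.cos (2 * (m + 1 : ℕ) * φ) : ℂ) • ψ)) (μ := 2 * μ)
        (hforce _ _ _ hμ (Real.abs_cos_le_one _) hψ)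
      have e2 : y m - (Real.sin ((2 * m + 1) * φ) : ℂ) • E ψ + (2 : ℂ) • A
          (x (m + 1) - (Real.cos (2 * (m + 1 : ℕ) * φ) : ℂ) • ψ) +
          (2 : ℂ) • Δ ((Real.cos (2 * (m + 1 : ℕ) * φ) : ℂ) • ψ) =
          y (m + 1) - (Real.sin ((2 * (m + 1 : ℕ) + 1) * φ) : ℂ) • E ψ := by
        have hexp : A ((Real.cos (2 * (m + 1 : ℕ) * φ) : ℂ) • ψ) =
            Δ ((Real.cos (2 * (m + 1 : ℕ) * φ) : ℂ) • ψ) +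
              ((Real.sin φ : ℂ) * (Real.cos (2 * (m + 1 : ℕ) * φ) : ℂ)) • E ψ := by
          conv_lhs => rw [hAΔ]
          rw [add_apply, smul_apply, map_smul E, smul_smul]
        rw [hy, trig2, map_sub, hexp, Complex.ofReal_add, Complex.ofReal_mul, Complex.ofReal_mul]
        push_cast
        module
      rw [e2] at h2
      refine h2.trans (le_of_eq ?_)
      push_cast
      ring
  -- Coercivity: with the square completed in `x`, the form dominates `‖v‖² - ‖A† v‖² ≥ (1 - c²)
  -- ‖v‖²`.
  refine le_trans ?_ (key m)
  rw [amplifyEnergy_eq_right]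
  set v := y m - (Real.sin ((2 * m + 1) * φ) : ℂ) • E ψ
  have hv : ‖adjoint A v‖ ≤ c * ‖v‖ := ((adjoint A).le_opNorm v).trans (by
    rw [LinearIsometryEquiv.norm_map]
    nlinarith [norm_nonneg v])
  nlinarith [norm_nonneg (adjoint A v), norm_nonneg v,
    sq_nonneg ‖x m - (Real.cos (2 * m * φ) : ℂ) • ψ - adjoint A v‖,
    pow_le_pow_left₀ (norm_nonneg _) hv 2]

end Stability

/-! ### Choice of angles, and an amplification error independent of the sub-normalization -/

section RobustAmplification

variable {b a s : ℕ} {U : Matrix (Reg (Fin a ⊕ Fin s)) (Reg (Fin a ⊕ Fin s)) ℂ}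

/-- The angle for which `m` iterations of amplitude amplification reach amplitude one. -/
noncomputable def amplifyAngle (m : ℕ) : ℝ := Real.pi / (2 * (2 * m + 1))

theorem sin_amplifyAngle_nonneg (m : ℕ) : 0 ≤ Real.sin (amplifyAngle m) := by
  refine Real.sin_nonneg_of_nonneg_of_le_pi (by unfold amplifyAngle; positivity) ?_
  exact div_le_self Real.pi_pos.le (by nlinarith [(Nat.cast_nonneg m : (0 : ℝ) ≤ m)])

theorem mul_sin_amplifyAngle_le (m : ℕ) :
    2 * (2 * m + 1) * Real.sin (amplifyAngle m) ≤ Real.pi := by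
  have h : Real.sin (amplifyAngle m) ≤ amplifyAngle m :=
    Real.sin_le (by unfold amplifyAngle; positivity)
  calc 2 * (2 * m + 1) * Real.sin (amplifyAngle m) ≤ 2 * (2 * m + 1) * amplifyAngle m := by gcongr
    _ = Real.pi := by unfold amplifyAngle; field_simp

/-- For `m ≥ 1` the angle is at most `π / 6`. This keeps the amplified block away from norm one,
where the energy would lose coercivity. -/
theorem sin_amplifyAngle_le_half {m : ℕ} (hm : 1 ≤ m) : Real.sin (amplifyAngle m) ≤ 1 / 2 := by
  have hm' : (1 : ℝ) ≤ m := by exact_mod_cast hm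
  rw [← Real.sin_pi_div_six]
  refine Real.sin_le_sin_of_le_of_le_pi_div_two ?_ (by linarith [Real.pi_pos]) ?_
  · have : 0 ≤ amplifyAngle m := by unfold amplifyAngle; positivity
    linarith [Real.pi_pos]
  · exact div_le_div_of_nonneg_left Real.pi_pos.le (by norm_num) (by linarith)

/-- The damping that turns the sub-normalization `α` into `sin (amplifyAngle ⌈α⌉₊)⁻¹`. -/
noncomputable def dampAngle (α : ℝ) : ℝ := Real.arccos (α * Real.sin (amplifyAngle ⌈α⌉₊))

/-- The argument of `arccos` is admissible because `sin φ ≤ π / (2 (2 m + 1))` and `α ≤ m` make it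
at most `π / 4 ≤ 1`. -/
theorem cos_dampAngle {α : ℝ} (hα : 0 ≤ α) :
    Real.cos (dampAngle α) = α * Real.sin (amplifyAngle ⌈α⌉₊) := by
  have h0 := sin_amplifyAngle_nonneg ⌈α⌉₊
  have h1 := mul_sin_amplifyAngle_le ⌈α⌉₊
  have h2 := Nat.le_ceil α
  refine Real.cos_arccos ((by norm_num : (-1 : ℝ) ≤ 0).trans (mul_nonneg hα h0)) ?_
  nlinarith [Real.pi_le_four, mul_le_mul_of_nonneg_right h2 h0]

theorem norm_outputState_le (hU : U ∈ Matrix.unitaryGroup (Reg (Fin a ⊕ Fin s)) ℂ)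
    (C : Circuit b a) (ψ : QState (Fin s)) : ‖outputState (C.eval U) ψ‖ ≤ ‖ψ‖ := by
  rw [outputState]
  refine (norm_flagged_le _).trans ?_
  rw [norm_applyOp_of_mem_unitaryGroup (C.eval_mem_unitaryGroup hU), norm_withZeroAncilla]

theorem norm_amplify_sub_le_four_mul (hU : U ∈ Matrix.unitaryGroup (Reg (Fin a ⊕ Fin s)) ℂ)
    {V : Circuit b a} {W : Matrix (Reg (Fin s)) (Reg (Fin s)) ℂ}
    (hW : W ∈ Matrix.unitaryGroup (Reg (Fin s)) ℂ) {α δ : ℝ}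
    (hV : IsBlockEncoding α δ (V.eval U) W) (hδ : δ ≤ 1 / 8) {ψ : QState (Fin s)}
    (hψ : ‖ψ‖ = 1) :
    ‖outputState (((V.damp (dampAngle α)).amplify ⌈α⌉₊).eval U) ψ - applyOp W ψ‖ ≤ 4 * δ := by
  have hα := hV.nonneg
  have hδ0 : 0 ≤ δ := (norm_nonneg _).trans hV.error_le
  -- If `α = 0`, the unitary `W` itself would have norm at most `δ ≤ 1 / 8`.
  have hm : 1 ≤ ⌈α⌉₊ := by
    rw [Nat.one_le_ceil_iff]
    refine lt_of_le_of_ne hα fun h => ?_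
    have h1 := hV.error_le
    rw [← h, Complex.ofReal_zero, zero_smul, sub_zero] at h1
    have h2 := norm_applyOp_le W ψ
    rw [norm_applyOp_of_mem_unitaryGroup hW, hψ] at h2
    linarith
  set m := ⌈α⌉₊ with hmdef
  set C := V.damp (dampAngle α) with hC
  set φ := amplifyAngle m with hφ
  have hs0 : 0 ≤ Real.sin φ := sin_amplifyAngle_nonneg m
  have hs1 : Real.sin φ ≤ 1 / 2 := sin_amplifyAngle_le_half hm
  have hblock : zeroBlock (C.eval U) = ((α * Real.sin φ : ℝ) : ℂ) • zeroBlock (V.eval U) := by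
    rw [hC, Circuit.zeroBlock_eval_damp, cos_dampAngle hα]
  let T := Matrix.toEuclideanCLM (n := Reg (Fin s)) (𝕜 := ℂ)
  have hTW : ContinuousLinearMap.adjoint (T W) * T W = 1 := by
    rw [← ContinuousLinearMap.star_eq_adjoint, ← map_star, ← map_mul,
      Matrix.mem_unitaryGroup_iff'.mp hW, map_one]
  have hTW1 : ‖T W‖ ≤ 1 := ContinuousLinearMap.opNorm_le_bound _ zero_le_one fun v => by
    rw [one_mul]
    exact (norm_applyOp_of_mem_unitaryGroup hW v).le
  have hμ : ‖T (zeroBlock (C.eval U)) - (Real.sin φ : ℂ) • T W‖ ≤ Real.sin φ * δ := by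
    have e : T (zeroBlock (C.eval U)) - (Real.sin φ : ℂ) • T W =
        (-Real.sin φ : ℂ) • T (W - (α : ℂ) • zeroBlock (V.eval U)) := by
      rw [hblock, map_smul, map_sub, map_smul]
      push_cast
      module
    rw [e, norm_smul, norm_neg, Complex.norm_real, Real.norm_eq_abs, abs_of_nonneg hs0]
    exact mul_le_mul_of_nonneg_left hV.error_le hs0
  -- `9 / 16 = 1 / 2 + (1 / 2) * (1 / 8)`, from `sin φ ≤ 1 / 2` and `δ ≤ 1 / 8`.
  have hAc : ‖T (zeroBlock (C.eval U))‖ ≤ 9 / 16 := by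
    have h1 := norm_add_le (T (zeroBlock (C.eval U)) - (Real.sin φ : ℂ) • T W)
      ((Real.sin φ : ℂ) • T W)
    rw [sub_add_cancel, norm_smul, Complex.norm_real, Real.norm_eq_abs, abs_of_nonneg hs0] at h1
    nlinarith [norm_nonneg (T W)]
  have hstar : T (zeroBlock (C.eval U)).conjTranspose =
      ContinuousLinearMap.adjoint (T (zeroBlock (C.eval U))) := by
    rw [← ContinuousLinearMap.star_eq_adjoint, ← map_star]
    rfl
  have key := norm_amplify_sub_le hTW hTW1 hμ hAc (by norm_num) hψ.le
    (x := fun k => T (Circuit.amplifyAux U C k) ψ)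
    (y := fun k => T (zeroBlock (Circuit.eval U (C.amplify k))) ψ)
    (by simp [Circuit.amplifyAux_zero hU]) (by simp [Circuit.amplify])
    (fun k => by
      simp only [Circuit.amplifyAux_succ hU, map_sub, map_smul, map_mul, hstar]
      rfl)
    (fun k => by
      simp only [Circuit.zeroBlock_amplify_succ hU, map_add, map_smul, map_mul]
      rfl) m
  have hangle : (2 * m + 1) * φ = Real.pi / 2 := by
    rw [hφ, amplifyAngle]
    field_simp
  rw [hangle, Real.sin_pi_div_two, Complex.ofReal_one, one_smul] at key
  -- The number of iterations drops out here: `(4 m + 1) sin φ ≤ 2 (2 m + 1) sin φ ≤ π`.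
  have hgrow : (4 * m + 1) * (Real.sin φ * δ) ≤ 3.15 * δ := by
    have h1 := mul_sin_amplifyAngle_le m
    have h2 := Real.pi_lt_d2
    nlinarith [mul_nonneg hs0 hδ0]
  have hgrow' := pow_le_pow_left₀ (by positivity) hgrow 2
  rw [outputState_eq]
  refine abs_le_of_sq_le_sq' ?_ (by positivity) |>.2
  have key' : (1 - (9 / 16 : ℝ) ^ 2) * ‖applyOp (zeroBlock (Circuit.eval U (C.amplify m))) ψ -
    applyOp W ψ‖ ^ 2 ≤ ((4 * m + 1) * (Real.sin φ * δ)) ^ 2 := key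
  -- The factor `4` suffices because `3.15² < 4² * (1 - (9 / 16)²)`.
  nlinarith

/-- For `δ > 1 / 8` the bound is trivial: both vectors have norm at most one, and `2 < 16 δ`. -/
theorem norm_amplify_sub_le_sixteen_mul
    (hU : U ∈ Matrix.unitaryGroup (Reg (Fin a ⊕ Fin s)) ℂ)
    {V : Circuit b a} {W : Matrix (Reg (Fin s)) (Reg (Fin s)) ℂ}
    (hW : W ∈ Matrix.unitaryGroup (Reg (Fin s)) ℂ) {α δ : ℝ}
    (hV : IsBlockEncoding α δ (V.eval U) W) {ψ : QState (Fin s)} (hψ : ‖ψ‖ = 1) :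
    ‖outputState (((V.damp (dampAngle α)).amplify ⌈α⌉₊).eval U) ψ - applyOp W ψ‖ ≤ 16 * δ := by
  have hδ0 : 0 ≤ δ := (norm_nonneg _).trans hV.error_le
  by_cases hδ : δ ≤ 1 / 8
  · linarith [norm_amplify_sub_le_four_mul hU hW hV hδ hψ]
  · have h1 := norm_outputState_le hU ((V.damp (dampAngle α)).amplify ⌈α⌉₊) ψ
    have h2 := norm_applyOp_of_mem_unitaryGroup hW ψ
    have h3 := norm_sub_le
      (outputState (((V.damp (dampAngle α)).amplify ⌈α⌉₊).eval U) ψ) (applyOp W ψ)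
    rw [not_le] at hδ
    linarith

end RobustAmplification

/-! ### Polynomials on the unit circle -/

section CirclePolynomials

open Polynomial

theorem Polynomial.eq_of_eval_circle {p q : ℂ[X]}
    (h : ∀ w : ℂ, ‖w‖ = 1 → p.eval w = q.eval w) : p = q := by
  refine Polynomial.eq_of_infinite_eval_eq p q (Set.Infinite.mono
    (s := Metric.sphere (0 : ℂ) 1) (fun w hw => h w (by simpa using hw)) ?_)
  refine (IsPreconnected.infinite_of_nontrivial (isPreconnected_sphere ?_ 0 1))
    ⟨1, by simp, -1, by simp, ?_⟩
  · rw [← Module.finrank_eq_rank ℝ ℂ]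
    simp
  · norm_num

/-- The polynomial `X ^ N * conj (f (1 / conj X))`. -/
noncomputable def conjReflect (N : ℕ) (f : ℂ[X]) : ℂ[X] := (f.map (starRingEnd ℂ)).reflect N

theorem coeff_zero_conjReflect (N : ℕ) (f : ℂ[X]) :
    (conjReflect N f).coeff 0 = starRingEnd ℂ (f.coeff N) := by
  rw [conjReflect, coeff_reflect, revAt_le (Nat.zero_le N), coeff_map, Nat.sub_zero]

theorem coeff_conjReflect_self (N : ℕ) (f : ℂ[X]) :
    (conjReflect N f).coeff N = starRingEnd ℂ (f.coeff 0) := by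
  rw [conjReflect, coeff_reflect, revAt_le le_rfl, coeff_map, Nat.sub_self]

theorem eval_conjReflect {N : ℕ} {f : ℂ[X]} (hf : f.natDegree ≤ N) {w : ℂ} (hw : w ≠ 0) :
    (conjReflect N f).eval w = w ^ N * starRingEnd ℂ (f.eval (starRingEnd ℂ w)⁻¹) := by
  let _ : Invertible (w⁻¹) := invertibleOfNonzero (inv_ne_zero hw)
  have h := eval₂_reflect_mul_pow (RingHom.id ℂ) (w⁻¹) N (f.map (starRingEnd ℂ))
    ((natDegree_map_le).trans hf)
  simp only [invOf_eq_inv, inv_inv, eval₂_id] at h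
  rw [conjReflect]
  have h2 : (f.map (starRingEnd ℂ)).eval w⁻¹ =
      starRingEnd ℂ (f.eval (starRingEnd ℂ w)⁻¹) := by
    rw [eval_map, ← eval₂_hom, map_inv₀, Complex.conj_conj]
  rw [← h2, ← h, inv_pow, mul_comm (w ^ N), mul_assoc, inv_mul_cancel₀ (pow_ne_zero N hw), mul_one]

theorem inv_conj_of_norm_one {w : ℂ} (hw : ‖w‖ = 1) : (starRingEnd ℂ w)⁻¹ = w := by
  have : w * starRingEnd ℂ w = 1 := by rw [Complex.mul_conj, Complex.normSq_eq_norm_sq, hw]; simp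
  exact (eq_inv_of_mul_eq_one_left this).symm

/-- **Fejér–Riesz**: a trigonometric polynomial that is positive on the unit circle is the squared
modulus of a polynomial. -/
theorem exists_normSq_eq_of_pos (d : ℕ) : ∀ F : ℂ[X], F.natDegree ≤ 2 * d →
    (∀ w : ℂ, ‖w‖ = 1 → ∃ r : ℝ, 0 < r ∧ F.eval w = r * w ^ d) →
    ∃ Q : ℂ[X], Q.natDegree ≤ d ∧
      ∀ w : ℂ, ‖w‖ = 1 → F.eval w = ((‖Q.eval w‖ ^ 2 : ℝ) : ℂ) * w ^ d := by
  induction d with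
  | zero =>
    intro F hF hpos
    obtain ⟨r, hr, h1⟩ := hpos 1 (by simp)
    have hFc : F = C (F.coeff 0) := eq_C_of_natDegree_le_zero (by simpa using hF)
    refine ⟨C ((Real.sqrt r : ℝ) : ℂ), by simp, fun w _ => ?_⟩
    rw [hFc] at h1 ⊢
    simp only [eval_C, pow_zero, mul_one] at h1 ⊢
    rw [h1, Complex.norm_real, Real.norm_eq_abs, sq_abs, Real.sq_sqrt hr.le]
  | succ d ih =>
    intro F hF hpos
    -- Reality of `F w / w ^ (d + 1)` on the circle makes `F` self-reciprocal, so the constant and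
    -- leading coefficients vanish together and roots come in pairs `r`, `1 / conj r`.
    have hsymm : conjReflect (2 * (d + 1)) F = F := by
      refine Polynomial.eq_of_eval_circle fun w hw => ?_
      have hw0 : w ≠ 0 := by rintro rfl; simp at hw
      obtain ⟨r, -, h⟩ := hpos w hw
      have hww : w * starRingEnd ℂ w = 1 := by
        rw [Complex.mul_conj, Complex.normSq_eq_norm_sq, hw]; simp
      rw [eval_conjReflect hF hw0, inv_conj_of_norm_one hw, h, map_mul, map_pow,
        Complex.conj_ofReal]
      calc w ^ (2 * (d + 1)) * (r * starRingEnd ℂ w ^ (d + 1))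
          = r * w ^ (d + 1) * (w * starRingEnd ℂ w) ^ (d + 1) := by ring
        _ = r * w ^ (d + 1) := by rw [hww]; ring
    by_cases h0 : F.coeff 0 = 0
    · -- divide by `X`
      obtain ⟨G, rfl⟩ := X_dvd_iff.mpr h0
      have htop : (X * G).coeff (2 * (d + 1)) = 0 := by
        rw [← hsymm, coeff_conjReflect_self, h0, map_zero]
      have hG : G.natDegree ≤ 2 * d := by
        rw [natDegree_le_iff_coeff_eq_zero]
        intro n hn
        rw [← coeff_X_mul]
        rcases Nat.lt_or_ge (2 * (d + 1)) (n + 1) with h | h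
        · exact coeff_eq_zero_of_natDegree_lt (lt_of_le_of_lt hF h)
        · rw [show n + 1 = 2 * (d + 1) by omega]
          exact htop
      obtain ⟨Q, hQ, hQe⟩ := ih G hG fun w hw => by
        have hw0 : w ≠ 0 := by rintro rfl; simp at hw
        obtain ⟨r, hr, h⟩ := hpos w hw
        refine ⟨r, hr, mul_left_cancel₀ hw0 ?_⟩
        rw [eval_mul, eval_X] at h
        rw [h]
        ring
      refine ⟨Q, hQ.trans (Nat.le_succ d), fun w hw => ?_⟩
      rw [eval_mul, eval_X, hQe w hw]
      ring
    · -- split off a root and its reflection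
      have hdeg : F.natDegree = 2 * (d + 1) := by
        refine le_antisymm hF (le_natDegree_of_ne_zero ?_)
        rw [← hsymm, coeff_conjReflect_self]
        exact (_root_.map_ne_zero _).mpr h0
      obtain ⟨r, hr⟩ := Complex.exists_root (f := F) (by
        rw [← natDegree_pos_iff_degree_pos, hdeg]; omega)
      have hr0 : r ≠ 0 := by
        rintro rfl
        exact h0 (by rw [coeff_zero_eq_eval_zero]; exact hr)
      have hrc : starRingEnd ℂ r ≠ 0 := (_root_.map_ne_zero _).mpr hr0
      -- Strict positivity excludes roots on the circle, so the two roots of a pair are distinct and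
      -- both can be divided out.
      have hr1 : ‖r‖ ≠ 1 := by
        intro h
        obtain ⟨t, ht, he⟩ := hpos r h
        rw [hr] at he
        have : (t : ℂ) * r ^ (d + 1) ≠ 0 :=
          mul_ne_zero (by exact_mod_cast ht.ne') (pow_ne_zero _ hr0)
        exact this he.symm
      have hr' : F.IsRoot (starRingEnd ℂ r)⁻¹ := by
        rw [IsRoot.def, ← hsymm, eval_conjReflect hF (inv_ne_zero hrc), map_inv₀,
          Complex.conj_conj, inv_inv, hr, map_zero, mul_zero]
      have hne : (starRingEnd ℂ r)⁻¹ ≠ r := by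
        intro h
        apply hr1
        have h2 : starRingEnd ℂ r * r = 1 := by
          nth_rewrite 2 [← h]
          exact mul_inv_cancel₀ hrc
        rw [mul_comm, Complex.mul_conj, Complex.normSq_eq_norm_sq] at h2
        have h3 : ‖r‖ ^ 2 = 1 := by exact_mod_cast h2
        nlinarith [norm_nonneg r]
      obtain ⟨G₁, hG₁⟩ := dvd_iff_isRoot.mpr hr
      have hr'' : G₁.IsRoot (starRingEnd ℂ r)⁻¹ := by
        rw [hG₁, IsRoot.def, eval_mul] at hr'
        refine (mul_eq_zero.mp hr').resolve_left ?_
        simpa [sub_eq_zero] using hne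
      obtain ⟨G₂, hG₂⟩ := dvd_iff_isRoot.mpr hr''
      have hG0 : G₂ ≠ 0 := by
        rintro rfl
        rw [hG₁, hG₂] at hdeg
        simp at hdeg
      have hdeg2 : G₂.natDegree ≤ 2 * d := by
        have h1 : F.natDegree = 1 + (1 + G₂.natDegree) := by
          rw [hG₁, hG₂, natDegree_mul (X_sub_C_ne_zero _) (mul_ne_zero (X_sub_C_ne_zero _) hG0),
            natDegree_mul (X_sub_C_ne_zero _) hG0, natDegree_X_sub_C, natDegree_X_sub_C]
        omega
      -- On the circle `w - 1 / conj r = -(1 / conj r) * w * conj (w - r)`. The pair of roots thus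
      -- contributes `|w - r|² w` up to a constant, and the quotient stays positive.
      have hfact : ∀ w : ℂ, ‖w‖ = 1 → F.eval w = ((‖w - r‖ ^ 2 : ℝ) : ℂ) * w *
          (C (-(starRingEnd ℂ r)⁻¹) * G₂).eval w := by
        intro w hw
        have hww : w * starRingEnd ℂ w = 1 := by
          rw [Complex.mul_conj, Complex.normSq_eq_norm_sq, hw]; simp
        rw [hG₁, hG₂]
        simp only [eval_mul, eval_sub, eval_X, eval_C]
        have : ((‖w - r‖ ^ 2 : ℝ) : ℂ) = (w - r) * (starRingEnd ℂ w - starRingEnd ℂ r) := by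
          rw [← map_sub, Complex.mul_conj, Complex.normSq_eq_norm_sq]
        rw [this]
        field_simp
        linear_combination ((w - r) * eval w G₂) * hww
      obtain ⟨Q, hQ, hQe⟩ := ih (C (-(starRingEnd ℂ r)⁻¹) * G₂)
        ((natDegree_C_mul_le _ _).trans hdeg2) fun w hw => by
          have hw0 : w ≠ 0 := by rintro rfl; simp at hw
          have hwr : w - r ≠ 0 := by
            intro h
            rw [sub_eq_zero] at h
            exact hr1 (h ▸ hw)
          obtain ⟨t, ht, he⟩ := hpos w hw
          have hpos' : 0 < ‖w - r‖ ^ 2 := by positivity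
          refine ⟨t / ‖w - r‖ ^ 2, by positivity, ?_⟩
          rw [hfact w hw] at he
          have hne' : ((‖w - r‖ ^ 2 : ℝ) : ℂ) ≠ 0 := by exact_mod_cast hpos'.ne'
          refine mul_left_cancel₀ (mul_ne_zero hne' hw0) ?_
          rw [he, Complex.ofReal_div]
          field_simp
          ring
      refine ⟨(X - C r) * Q, ?_, fun w hw => ?_⟩
      · refine natDegree_mul_le.trans ?_
        rw [natDegree_X_sub_C]
        omega
      · rw [hfact w hw, hQe w hw, eval_mul, norm_mul, mul_pow]
        simp only [eval_sub, eval_X, eval_C, Complex.ofReal_mul]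
        ring

/-- A polynomial of modulus less than one on the unit circle is an entry of a unit vector of
polynomials. -/
theorem exists_complementary {d : ℕ} {P : ℂ[X]} (hP : P.natDegree ≤ d)
    (h1 : ∀ w : ℂ, ‖w‖ = 1 → ‖P.eval w‖ < 1) :
    ∃ Q : ℂ[X], Q.natDegree ≤ d ∧ ∀ w : ℂ, ‖w‖ = 1 → ‖P.eval w‖ ^ 2 + ‖Q.eval w‖ ^ 2 = 1 := by
  -- Fejér–Riesz is applied to `1 - |P|²`, cleared of negative powers by `w ^ d`.
  have he : ∀ w : ℂ, ‖w‖ = 1 → (X ^ d - P * conjReflect d P).eval w =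
      ((1 - ‖P.eval w‖ ^ 2 : ℝ) : ℂ) * w ^ d := by
    intro w hw
    have hw0 : w ≠ 0 := by rintro rfl; simp at hw
    have h2 : ((‖P.eval w‖ ^ 2 : ℝ) : ℂ) = P.eval w * starRingEnd ℂ (P.eval w) := by
      rw [Complex.mul_conj, Complex.normSq_eq_norm_sq]
    rw [Complex.ofReal_sub, h2, eval_sub, eval_mul, eval_pow, eval_X, eval_conjReflect hP hw0,
      inv_conj_of_norm_one hw, Complex.ofReal_one]
    ring
  obtain ⟨Q, hQ, hQe⟩ := exists_normSq_eq_of_pos d (X ^ d - P * conjReflect d P) (by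
    refine (natDegree_sub_le _ _).trans (max_le ?_ (natDegree_mul_le.trans ?_))
    · rw [natDegree_X_pow]; omega
    · have : (conjReflect d P).natDegree ≤ d := by
        rw [conjReflect]
        refine (natDegree_reflect_le ..).trans (max_le le_rfl (natDegree_map_le.trans hP))
      omega) fun w hw => ⟨1 - ‖P.eval w‖ ^ 2, by nlinarith [h1 w hw, norm_nonneg (P.eval w)], he w hw⟩
  refine ⟨Q, hQ, fun w hw => ?_⟩
  have hw0 : w ≠ 0 := by rintro rfl; simp at hw
  have h3 := (he w hw).symm.trans (hQe w hw)
  have h4 : (1 - ‖P.eval w‖ ^ 2 : ℝ) = ‖Q.eval w‖ ^ 2 :=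
    Complex.ofReal_injective (mul_right_cancel₀ (pow_ne_zero d hw0) h3)
  linarith

/-- The special unitary matrix with first column `(p, q)`. -/
noncomputable def unitaryOfColumn (p q : ℂ) : Matrix (Fin 2) (Fin 2) ℂ :=
  !![p, -starRingEnd ℂ q; q, starRingEnd ℂ p]

theorem mul_conj_eq_norm_sq (z : ℂ) : z * starRingEnd ℂ z = ((‖z‖ ^ 2 : ℝ) : ℂ) := by
  rw [Complex.mul_conj, Complex.normSq_eq_norm_sq]

theorem exists_unit_proportional {x y : ℂ} (h : ¬(x = 0 ∧ y = 0)) :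
    ∃ p q r : ℂ, ‖p‖ ^ 2 + ‖q‖ ^ 2 = 1 ∧ r ≠ 0 ∧ x = r * p ∧ y = r * q := by
  have hpos : 0 < ‖x‖ ^ 2 + ‖y‖ ^ 2 := by
    by_cases hx : x = 0
    · have : 0 < ‖y‖ := norm_pos_iff.mpr fun hy => h ⟨hx, hy⟩
      positivity
    · have : 0 < ‖x‖ := norm_pos_iff.mpr hx
      positivity
  set n := Real.sqrt (‖x‖ ^ 2 + ‖y‖ ^ 2) with hn
  have hn0 : 0 < n := Real.sqrt_pos.mpr hpos
  have hnc : (n : ℂ) ≠ 0 := by exact_mod_cast hn0.ne'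
  refine ⟨x / n, y / n, n, ?_, hnc, by field_simp, by field_simp⟩
  rw [norm_div, norm_div, Complex.norm_real, Real.norm_eq_abs, abs_of_pos hn0, div_pow, div_pow,
    hn, Real.sq_sqrt hpos.le, ← add_div, div_self hpos.ne']

/-- `(p, q)` is the direction of `t`, which is orthogonal to `v`. If `t = 0`, any unit vector
orthogonal to `v` works. -/
theorem exists_unit_of_orthogonal {v₀ v₁ t₀ t₁ : ℂ}
    (h : v₀ * starRingEnd ℂ t₀ + v₁ * starRingEnd ℂ t₁ = 0) :
    ∃ p q : ℂ, ‖p‖ ^ 2 + ‖q‖ ^ 2 = 1 ∧ starRingEnd ℂ p * v₀ + starRingEnd ℂ q * v₁ = 0 ∧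
      -q * t₀ + p * t₁ = 0 := by
  by_cases ht : t₀ = 0 ∧ t₁ = 0
  · by_cases hv : v₀ = 0 ∧ v₁ = 0
    · exact ⟨1, 0, by simp, by simp [hv.1, hv.2], by simp [ht.1, ht.2]⟩
    · obtain ⟨p, q, r, hpq, -, h0, h1⟩ := exists_unit_proportional hv
      refine ⟨-starRingEnd ℂ q, starRingEnd ℂ p, ?_, ?_, by simp [ht.1, ht.2]⟩
      · simp only [norm_neg, RCLike.norm_conj]
        linarith
      · rw [h0, h1]
        simp only [map_neg, Complex.conj_conj]
        ring
  · obtain ⟨p, q, r, hpq, hr, h0, h1⟩ := exists_unit_proportional ht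
    refine ⟨p, q, hpq, ?_, by rw [h0, h1]; ring⟩
    rw [h0, h1, map_mul, map_mul] at h
    refine (mul_eq_zero.mp (?_ : starRingEnd ℂ r * _ = 0)).resolve_left
      ((_root_.map_ne_zero _).mpr hr)
    rw [← h]
    ring

/-- Vectors of two polynomials of degree at most `d` that are unit vectors on the unit circle. -/
structure IsUnitPair (d : ℕ) (f : Fin 2 → ℂ[X]) : Prop where
  natDegree_le : ∀ i, (f i).natDegree ≤ d
  norm_eq : ∀ w : ℂ, ‖w‖ = 1 → ‖(f 0).eval w‖ ^ 2 + ‖(f 1).eval w‖ ^ 2 = 1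

/-- The unit condition is a polynomial identity with right-hand side `X ^ (d + 1)`. Its constant
coefficient is the asserted inner product. -/
theorem IsUnitPair.coeff_orthogonal {d : ℕ} {f : Fin 2 → ℂ[X]} (hf : IsUnitPair (d + 1) f) :
    (f 0).coeff 0 * starRingEnd ℂ ((f 0).coeff (d + 1)) +
      (f 1).coeff 0 * starRingEnd ℂ ((f 1).coeff (d + 1)) = 0 := by
  have h : f 0 * conjReflect (d + 1) (f 0) + f 1 * conjReflect (d + 1) (f 1) = X ^ (d + 1) := by
    refine Polynomial.eq_of_eval_circle fun w hw => ?_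
    have hw0 : w ≠ 0 := by rintro rfl; simp at hw
    rw [eval_add, eval_mul, eval_mul, eval_conjReflect (hf.natDegree_le 0) hw0,
      eval_conjReflect (hf.natDegree_le 1) hw0, inv_conj_of_norm_one hw, eval_pow, eval_X]
    have h1 := congrArg (fun r : ℝ => (r : ℂ)) (hf.norm_eq w hw)
    simp only [Complex.ofReal_add, ← mul_conj_eq_norm_sq, Complex.ofReal_one] at h1
    linear_combination w ^ (d + 1) * h1
  have h0 := congrArg (fun p : ℂ[X] => p.coeff 0) h
  simpa [mul_coeff_zero, coeff_zero_conjReflect, coeff_X_pow] using h0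

theorem IsUnitPair.exists_eq_zero {f : Fin 2 → ℂ[X]} (hf : IsUnitPair 0 f) :
    ∃ p q : ℂ, ‖p‖ ^ 2 + ‖q‖ ^ 2 = 1 ∧ ∀ i, f i = C (unitaryOfColumn p q i 0) := by
  have hc : ∀ i, f i = C ((f i).coeff 0) := fun i =>
    eq_C_of_natDegree_le_zero (hf.natDegree_le i)
  refine ⟨(f 0).coeff 0, (f 1).coeff 0, ?_, fun i => ?_⟩
  · have h := hf.norm_eq 1 (by simp)
    rwa [hc 0, hc 1, eval_C, eval_C] at h
  · fin_cases i
    · exact hc 0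
    · exact hc 1

/-- One layer of signal processing is peeled off. The inverse unitary must kill the constant
coefficient of the first component, making it divisible by `X`, and the top coefficient of the
second. Orthogonality of the two coefficient vectors lets one unitary do both. -/
theorem IsUnitPair.exists_eq_succ {d : ℕ} {f : Fin 2 → ℂ[X]} (hf : IsUnitPair (d + 1) f) :
    ∃ (p q : ℂ) (g : Fin 2 → ℂ[X]), ‖p‖ ^ 2 + ‖q‖ ^ 2 = 1 ∧ IsUnitPair d g ∧
      ∀ i, f i = C (unitaryOfColumn p q i 0) * (X * g 0) + C (unitaryOfColumn p q i 1) * g 1 := by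
  obtain ⟨p, q, hpq, h0, h1⟩ := exists_unit_of_orthogonal hf.coeff_orthogonal
  have hpq' : p * starRingEnd ℂ p + q * starRingEnd ℂ q = 1 := by
    rw [mul_conj_eq_norm_sq, mul_conj_eq_norm_sq, ← Complex.ofReal_add, hpq, Complex.ofReal_one]
  have hdeg : ∀ x y : ℂ, (C x * f 0 + C y * f 1).natDegree ≤ d + 1 := fun x y =>
    natDegree_add_le_of_degree_le ((natDegree_C_mul_le _ _).trans (hf.natDegree_le 0))
      ((natDegree_C_mul_le _ _).trans (hf.natDegree_le 1))
  obtain ⟨g₀, hg₀⟩ : X ∣ C (starRingEnd ℂ p) * f 0 + C (starRingEnd ℂ q) * f 1 := by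
    rw [X_dvd_iff, coeff_add, coeff_C_mul, coeff_C_mul, h0]
  have hC : C p * C (starRingEnd ℂ p) + C q * C (starRingEnd ℂ q) = 1 := by
    rw [← C_mul, ← C_mul, ← C_add, hpq', C_1]
  refine ⟨p, q, ![g₀, C (-q) * f 0 + C p * f 1], hpq, ⟨fun i => ?_, fun w hw => ?_⟩, fun i => ?_⟩
  · fin_cases i
    · have h := hdeg (starRingEnd ℂ p) (starRingEnd ℂ q)
      rw [hg₀] at h
      change g₀.natDegree ≤ d
      by_cases hg : g₀ = 0
      · simp [hg]
      · rw [natDegree_X_mul hg] at h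
        omega
    · change (C (-q) * f 0 + C p * f 1).natDegree ≤ d
      rw [natDegree_le_iff_coeff_eq_zero]
      intro n hn
      rcases Nat.lt_or_ge (d + 1) n with h | h
      · exact coeff_eq_zero_of_natDegree_lt (lt_of_le_of_lt (hdeg _ _) h)
      · obtain rfl : n = d + 1 := by omega
        rw [coeff_add, coeff_C_mul, coeff_C_mul, h1]
  · have hw' : ‖g₀.eval w‖ = ‖starRingEnd ℂ p * (f 0).eval w + starRingEnd ℂ q * (f 1).eval w‖ := by
      have := congrArg (fun P : ℂ[X] => ‖P.eval w‖) hg₀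
      simp only [eval_add, eval_mul, eval_C, eval_X, norm_mul, hw, one_mul] at this
      exact this.symm
    have hn := hf.norm_eq w hw
    simp only [Matrix.cons_val_zero, Matrix.cons_val_one, hw', eval_add, eval_mul, eval_C]
    rw [← hn]
    apply Complex.ofReal_injective
    simp only [Complex.ofReal_add, ← mul_conj_eq_norm_sq, map_add, map_mul, map_neg,
      Complex.conj_conj]
    linear_combination ((f 0).eval w * starRingEnd ℂ ((f 0).eval w) +
      (f 1).eval w * starRingEnd ℂ ((f 1).eval w)) * hpq'
  · simp only [Matrix.cons_val_zero, Matrix.cons_val_one, ← hg₀]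
    fin_cases i
    · simp only [unitaryOfColumn, Fin.zero_eta, Matrix.of_apply, Matrix.cons_val', Matrix.cons_val_zero,
        Matrix.cons_val_one, Matrix.cons_val_fin_one, C_neg]
      linear_combination (-f 0) * hC
    · simp only [unitaryOfColumn, Fin.mk_one, Matrix.of_apply, Matrix.cons_val', Matrix.cons_val_zero,
        Matrix.cons_val_one, Matrix.cons_val_fin_one, C_neg]
      linear_combination (-f 1) * hC

end CirclePolynomials

/-! ### The action of circuits on the branches of the work register -/

section Branches

variable {b a s : ℕ}

/-- The basis state with work qubits `ω` and the remaining qubits in the state `x`. -/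
def joinWork (ω : Reg (Fin b)) (x : Reg (Fin a ⊕ Fin s)) : Reg (Wires b a s) :=
  Sum.elim (Sum.elim ω fun j => x (Sum.inl j)) fun j => x (Sum.inr j)

/-- The operator that acts on the qubits outside the work register when the work register starts in
`0` and is found in `ω`. -/
def branch (M : Matrix (Reg (Wires b a s)) (Reg (Wires b a s)) ℂ) (ω : Reg (Fin b)) :
    Matrix (Reg (Fin a ⊕ Fin s)) (Reg (Fin a ⊕ Fin s)) ℂ :=
  Matrix.of fun x y => M (joinWork ω x) (joinWork 0 y)

/-- Circuits are analysed branch by branch: calls multiply each branch, work gates mix branches with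
scalar coefficients, and phases by `π` insert reflections. This identity returns to the encoded
block. -/
theorem zeroBlock_branch_zero (M : Matrix (Reg (Wires b a s)) (Reg (Wires b a s)) ℂ) :
    zeroBlock (branch M 0) = zeroBlock M := by
  have h : ∀ x : Reg (Fin s), joinWork (0 : Reg (Fin b))
      (Sum.elim (fun _ : Fin a => 0) x) = Sum.elim (fun _ => 0) x := by
    intro x
    funext k
    rcases k with (k | k) | k <;> rfl
  ext x y
  simp only [zeroBlock, branch, Matrix.of_apply, h]

theorem joinWork_injective : Function.Injective2 (joinWork (b := b) (a := a) (s := s)) := by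
  intro ω ω' x x' h
  refine ⟨funext fun q => congrFun h (Sum.inl (Sum.inl q)), funext fun k => ?_⟩
  rcases k with k | k
  · exact congrFun h (Sum.inl (Sum.inr k))
  · exact congrFun h (Sum.inr k)

theorem branch_one (ω : Reg (Fin b)) :
    branch (1 : Matrix (Reg (Wires b a s)) (Reg (Wires b a s)) ℂ) ω = if ω = 0 then 1 else 0 := by
  ext x y
  simp only [branch, Matrix.of_apply, Matrix.one_apply, joinWork_injective.eq_iff]
  by_cases h : ω = 0
  · simp [h, Matrix.one_apply]
  · simp [h]

theorem joinWork_comp_callWires (ω : Reg (Fin b)) (x : Reg (Fin a ⊕ Fin s)) :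
    (fun k => joinWork ω x (callWires b a s k)) = x := by
  funext k
  rcases k with k | k <;> rfl

theorem extend_callWires_joinWork (ω : Reg (Fin b)) (x z : Reg (Fin a ⊕ Fin s)) :
    Function.extend (callWires b a s) z (joinWork ω x) = joinWork ω z := by
  funext k
  rcases k with (k | k) | k
  · exact Function.extend_apply' _ _ _ fun ⟨j, hj⟩ => callWires_ne k j hj
  · exact extend_embedding_apply (callWires b a s) z _ (Sum.inl k)
  · exact extend_embedding_apply (callWires b a s) z _ (Sum.inr k)

theorem branch_onQubits_callWires_mul (u : Matrix (Reg (Fin a ⊕ Fin s)) (Reg (Fin a ⊕ Fin s)) ℂ)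
    (M : Matrix (Reg (Wires b a s)) (Reg (Wires b a s)) ℂ) (ω : Reg (Fin b)) :
    branch (onQubits (callWires b a s) u * M) ω = u * branch M ω := by
  ext x y
  rw [branch, Matrix.of_apply, Matrix.mul_apply, Matrix.mul_apply]
  have h := sum_onQubits_smul (callWires b a s) u (joinWork ω x) fun z => M z (joinWork 0 y)
  simp only [joinWork_comp_callWires, extend_callWires_joinWork, smul_eq_mul] at h
  exact h

theorem branch_controlledOn_callWires_mul (q : Fin b)
    (u : Matrix (Reg (Fin a ⊕ Fin s)) (Reg (Fin a ⊕ Fin s)) ℂ)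
    (M : Matrix (Reg (Wires b a s)) (Reg (Wires b a s)) ℂ) (ω : Reg (Fin b)) :
    branch (controlledOn (Sum.inl (Sum.inl q)) (onQubits (callWires b a s) u) * M) ω =
      if ω q = 1 then u * branch M ω else branch M ω := by
  by_cases hq : ω q = 1
  · rw [if_pos hq, ← branch_onQubits_callWires_mul]
    ext x y
    rw [branch, branch, Matrix.of_apply, Matrix.of_apply, Matrix.mul_apply, Matrix.mul_apply]
    refine Finset.sum_congr rfl fun z _ => ?_
    congr 1
    have hx : joinWork ω x (Sum.inl (Sum.inl q)) = 1 := hq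
    simp only [controlledOn, Matrix.of_apply, if_pos hx]
    split_ifs with h
    · rfl
    · rw [onQubits_apply_of_not_agree]
      exact fun h' => h (h' _ (callWires_ne q))
  · rw [if_neg hq]
    ext x y
    rw [branch, branch, Matrix.of_apply, Matrix.of_apply, Matrix.mul_apply]
    have hx : ¬ joinWork ω x (Sum.inl (Sum.inl q)) = 1 := hq
    rw [Finset.sum_eq_single (joinWork ω x)]
    · simp [controlledOn, hx]
    · intro z _ hz
      simp [controlledOn, hx, hz.symm]
    · simp

theorem branch_work_mul {U : Matrix (Reg (Fin a ⊕ Fin s)) (Reg (Fin a ⊕ Fin s)) ℂ}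
    (g : LocalGate (Fin b)) (M : Matrix (Reg (Wires b a s)) (Reg (Wires b a s)) ℂ)
    (ω : Reg (Fin b)) :
    branch ((Gate.work g : Gate b a).eval U * M) ω =
      ∑ z, (g.op : Matrix (Reg (Fin g.arity)) (Reg (Fin g.arity)) ℂ) (fun k => ω (g.wires k)) z •
        branch M (Function.extend g.wires z ω) := by
  let f : Fin g.arity ↪ Wires b a s :=
    g.wires.trans (Function.Embedding.inl.trans Function.Embedding.inl)
  have hext : ∀ (z : Reg (Fin g.arity)) (x : Reg (Fin a ⊕ Fin s)),
      Function.extend f z (joinWork ω x) = joinWork (Function.extend g.wires z ω) x := by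
    intro z x
    funext k
    rcases k with (k | k) | k
    · by_cases hk : ∃ j, g.wires j = k
      · obtain ⟨j, rfl⟩ := hk
        exact (extend_embedding_apply f z _ j).trans (extend_embedding_apply g.wires z _ j).symm
      · refine (Function.extend_apply' _ _ _ ?_).trans (Function.extend_apply' _ _ _ hk).symm
        rintro ⟨j, hj⟩
        exact hk ⟨j, Sum.inl_injective (Sum.inl_injective hj)⟩
    · refine Function.extend_apply' _ _ _ ?_
      rintro ⟨j, hj⟩
      exact Sum.inl_ne_inr (Sum.inl_injective hj)
    · refine Function.extend_apply' _ _ _ ?_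
      rintro ⟨j, hj⟩
      exact Sum.inl_ne_inr hj
  ext x y
  rw [branch, Matrix.of_apply, Matrix.mul_apply, Matrix.sum_apply]
  have h := sum_onQubits_smul f g.op (joinWork ω x) fun z => M z (joinWork 0 y)
  simp only [hext] at h
  exact h

theorem branch_phase_mul {U : Matrix (Reg (Fin a ⊕ Fin s)) (Reg (Fin a ⊕ Fin s)) ℂ}
    (p : Fin b → Option (Fin 2)) (M : Matrix (Reg (Wires b a s)) (Reg (Wires b a s)) ℂ)
    (ω : Reg (Fin b)) :
    branch ((Gate.phase Real.pi p true : Gate b a).eval U * M) ω =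
      if ∀ q v, p q = some v → ω q = v then zeroReflection (Fin a) (Fin s) * branch M ω
      else branch M ω := by
  ext x y
  rw [branch, Matrix.of_apply]
  simp only [Gate.eval, Matrix.diagonal_mul]
  have hexp : Complex.exp (Complex.I * Real.pi) = -1 := by rw [mul_comm, Complex.exp_pi_mul_I]
  by_cases h : ∀ q v, p q = some v → ω q = v
  · rw [if_pos h, zeroReflection_eq_diagonal, Matrix.diagonal_mul]
    by_cases ha : ∀ j, x (Sum.inl j) = 0
    · rw [if_pos ha, ← hexp]
      exact congrArg (· * _) (if_pos ⟨h, fun _ => ha⟩)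
    · rw [if_neg ha]
      exact congrArg (· * _) (if_neg fun h' => ha (h'.2 trivial))
  · rw [if_neg h]
    exact (congrArg (· * _) (if_neg fun h' => h h'.1)).trans (one_mul _)

end Branches

/-! ### Quantum signal processing with alternating calls -/

section SignalProcessing

open Polynomial

variable {a s : ℕ}

/-- The call that is used in step `j`: `U` in even steps and `U†` in odd steps. -/
def alternatingCall (U : Matrix (Reg (Fin a ⊕ Fin s)) (Reg (Fin a ⊕ Fin s)) ℂ) (j : ℕ) :
    Matrix (Reg (Fin a ⊕ Fin s)) (Reg (Fin a ⊕ Fin s)) ℂ :=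
  if j.bodd then U.conjTranspose else U

theorem alternatingCall_succ_mul {U : Matrix (Reg (Fin a ⊕ Fin s)) (Reg (Fin a ⊕ Fin s)) ℂ}
    (hU : U ∈ Matrix.unitaryGroup (Reg (Fin a ⊕ Fin s)) ℂ) (j : ℕ) :
    alternatingCall U (j + 1) * alternatingCall U j = 1 := by
  have h1 := Matrix.mem_unitaryGroup_iff.mp hU
  have h2 := Matrix.mem_unitaryGroup_iff'.mp hU
  rw [Matrix.star_eq_conjTranspose] at h1 h2
  rw [alternatingCall, alternatingCall, Nat.bodd_succ]
  cases j.bodd <;> simp [h1, h2]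

/-- The operator that `j` steps of quantum signal processing assign to a polynomial. -/
noncomputable def signalOp (U : Matrix (Reg (Fin a ⊕ Fin s)) (Reg (Fin a ⊕ Fin s)) ℂ) :
    ℕ → ℂ[X] →ₗ[ℂ] Matrix (Reg (Fin a ⊕ Fin s)) (Reg (Fin a ⊕ Fin s)) ℂ
  | 0 => (aeval (U.conjTranspose * zeroReflection (Fin a) (Fin s) * U *
      zeroReflection (Fin a) (Fin s))).toLinearMap
  | j + 1 => (LinearMap.mulLeft ℂ (zeroReflection (Fin a) (Fin s) * alternatingCall U j)).comp
      (signalOp U j)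

variable {U : Matrix (Reg (Fin a ⊕ Fin s)) (Reg (Fin a ⊕ Fin s)) ℂ}

theorem signalOp_zero_C (z : ℂ) : signalOp U 0 (C z) = z • 1 := by
  change aeval _ (C z) = _
  rw [aeval_C, Algebra.algebraMap_eq_smul_one]

theorem signalOp_succ (j : ℕ) (f : ℂ[X]) : signalOp U (j + 1) f =
    zeroReflection (Fin a) (Fin s) * (alternatingCall U j * signalOp U j f) := by
  rw [← mul_assoc]
  rfl

/-- Moving the reflection from after the call to before it multiplies the polynomial by `X`. For one
step this is the choice `X = U† R U R`. In the inductive step both sides collapse to `signalOp U j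
f`, because consecutive calls and paired reflections cancel. -/
theorem signalOp_succ_X_mul (hU : U ∈ Matrix.unitaryGroup (Reg (Fin a ⊕ Fin s)) ℂ) (j : ℕ) :
    ∀ f : ℂ[X], signalOp U (j + 1) (X * f) =
      alternatingCall U j * (zeroReflection (Fin a) (Fin s) * signalOp U j f) := by
  have hR : ∀ M : Matrix (Reg (Fin a ⊕ Fin s)) (Reg (Fin a ⊕ Fin s)) ℂ,
      zeroReflection (Fin a) (Fin s) * (zeroReflection (Fin a) (Fin s) * M) = M := fun M => by
    rw [← mul_assoc, zeroReflection_mul_self, one_mul]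
  have hA : ∀ (i : ℕ) (M : Matrix (Reg (Fin a ⊕ Fin s)) (Reg (Fin a ⊕ Fin s)) ℂ),
      alternatingCall U (i + 1) * (alternatingCall U i * M) = M := fun i M => by
    rw [← mul_assoc, alternatingCall_succ_mul hU, one_mul]
  induction j with
  | zero =>
    intro f
    have h1 := Matrix.mem_unitaryGroup_iff.mp hU
    rw [Matrix.star_eq_conjTranspose] at h1
    rw [signalOp_succ]
    have e : signalOp U 0 (X * f) = U.conjTranspose * zeroReflection (Fin a) (Fin s) * U *
        zeroReflection (Fin a) (Fin s) * signalOp U 0 f := by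
      change aeval _ (X * f) = _ * aeval _ f
      rw [map_mul, aeval_X]
    have e0 : alternatingCall U 0 = U := by simp [alternatingCall]
    rw [e, e0]
    simp only [mul_assoc]
    rw [← mul_assoc U U.conjTranspose, h1, one_mul, hR]
  | succ j ih =>
    intro f
    rw [signalOp_succ, ih f, hA, hR, signalOp_succ, hR, hA]

/-- The two added steps form `R A_{j+1} A_j R = 1`. Monomial factors thus bring series terms of
equal parity to a common word length. -/
theorem signalOp_add_two_X_mul (hU : U ∈ Matrix.unitaryGroup (Reg (Fin a ⊕ Fin s)) ℂ) (j : ℕ)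
    (f : ℂ[X]) : signalOp U (j + 2) (X * f) = signalOp U j f := by
  rw [signalOp_succ, signalOp_succ_X_mul hU, ← mul_assoc (alternatingCall U (j + 1)),
    alternatingCall_succ_mul hU, one_mul, ← mul_assoc, zeroReflection_mul_self, one_mul]

theorem signalOp_add_X_pow_mul (hU : U ∈ Matrix.unitaryGroup (Reg (Fin a ⊕ Fin s)) ℂ) (j l : ℕ)
    (f : ℂ[X]) : signalOp U (j + 2 * l) (X ^ l * f) = signalOp U j f := by
  induction l with
  | zero => simp
  | succ l ih =>
    rw [show j + 2 * (l + 1) = j + 2 * l + 2 by ring, pow_succ', mul_assoc,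
      signalOp_add_two_X_mul hU, ih]

/-- The block of `A R S` is that of `A S` minus twice the product of blocks, while the block of `R A
S` is minus that of `A S`. Averaging leaves only the product. -/
theorem zeroBlock_signalOp_succ (hU : U ∈ Matrix.unitaryGroup (Reg (Fin a ⊕ Fin s)) ℂ) (j : ℕ)
    (f : ℂ[X]) : zeroBlock (signalOp U (j + 1) (C (1 / 2) * (X + 1) * f)) =
      -(zeroBlock (alternatingCall U j) * zeroBlock (signalOp U j f)) := by
  have e : C (1 / 2) * (X + 1) * f = (1 / 2 : ℂ) • (X * f + f) := by
    rw [smul_eq_C_mul]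
    ring
  rw [e, map_smul, map_add, zeroBlock_smul, zeroBlock_add, signalOp_succ_X_mul hU, signalOp_succ,
    zeroBlock_zeroReflection_mul, ← mul_assoc, zeroBlock_mul_zeroReflection_mul]
  module

/-- The step-`k` block of a signal processing sequence is a power of the encoded operator. -/
theorem smul_zeroBlock_signalOp (hU : U ∈ Matrix.unitaryGroup (Reg (Fin a ⊕ Fin s)) ℂ)
    {H : Matrix (Reg (Fin s)) (Reg (Fin s)) ℂ} (hH : H.IsHermitian) {α : ℝ}
    (hblock : (α : ℂ) • zeroBlock U = H) (t : ℂ) (k : ℕ) :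
    (t * α) ^ k • zeroBlock (signalOp U k ((C (1 / 2) * (X + 1)) ^ k)) = ((-t) • H) ^ k := by
  -- Hermiticity of `H` makes `U` and `U†` encode the same operator.
  have hcall : ∀ j, (α : ℂ) • zeroBlock (alternatingCall U j) = H := by
    intro j
    rw [alternatingCall]
    split_ifs
    · rw [zeroBlock_conjTranspose]
      have h := congrArg Matrix.conjTranspose hblock
      rw [Matrix.conjTranspose_smul, hH] at h
      simpa using h
    · exact hblock
  induction k with
  | zero =>
    have : signalOp U 0 (C 1) = 1 := by rw [signalOp_zero_C, one_smul]
    rw [C_1] at this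
    simp [this, zeroBlock_one]
  | succ k ih =>
    rw [pow_succ' (C (1 / 2) * _), zeroBlock_signalOp_succ hU, pow_succ' ((-t) • H), ← ih,
      ← hcall k, pow_succ', smul_neg, Matrix.smul_mul, Matrix.smul_mul, Matrix.mul_smul, smul_smul,
      smul_smul, ← neg_smul]
    congr 1
    ring

end SignalProcessing

/-! ### Signal processing circuits with two parallel sequences

Work qubit `0` carries the sequence, work qubit `1` selects one of two sequences. -/

section TwoSequences

open Polynomial

variable {a s : ℕ}

/-- The two-qubit unitary that applies `unitaryOfColumn (p e) (q e)` to its first qubit if its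
second qubit is in the state `e`. -/
noncomputable def multiplexed (p q : Fin 2 → ℂ) : Matrix (Reg (Fin 2)) (Reg (Fin 2)) ℂ :=
  Matrix.of fun x y => if x 1 = y 1 then unitaryOfColumn (p (x 1)) (q (x 1)) (x 0) (y 0) else 0

theorem sum_multiplexed_smul {E : Type*} [AddCommGroup E] [Module ℂ E] (p q : Fin 2 → ℂ)
    (x : Reg (Fin 2)) (Ψ : Reg (Fin 2) → E) : ∑ z, multiplexed p q x z • Ψ z =
      ∑ i, unitaryOfColumn (p (x 1)) (q (x 1)) (x 0) i • Ψ ![i, x 1] := by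
  symm
  refine Finset.sum_of_injOn (fun i => ![i, x 1]) ?_ (by simp) ?_ ?_
  · intro i _ j _ h
    exact congrFun h 0
  · intro z _ hz
    rw [multiplexed, Matrix.of_apply, if_neg, zero_smul]
    intro h
    refine hz ⟨z 0, by simp, ?_⟩
    funext k
    fin_cases k
    · rfl
    · exact h
  · intro i _
    simp [multiplexed]

theorem unitaryOfColumn_mem {p q : ℂ} (h : ‖p‖ ^ 2 + ‖q‖ ^ 2 = 1) :
    unitaryOfColumn p q ∈ Matrix.unitaryGroup (Fin 2) ℂ := by
  have h' : p * starRingEnd ℂ p + q * starRingEnd ℂ q = 1 := by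
    rw [mul_conj_eq_norm_sq, mul_conj_eq_norm_sq, ← Complex.ofReal_add, h, Complex.ofReal_one]
  rw [Matrix.mem_unitaryGroup_iff]
  ext i j
  fin_cases i <;> fin_cases j <;>
    simp [unitaryOfColumn, Matrix.mul_apply, Matrix.star_apply] <;>
    first | linear_combination h' | ring

theorem multiplexed_mem {p q : Fin 2 → ℂ} (h : ∀ e, ‖p e‖ ^ 2 + ‖q e‖ ^ 2 = 1) :
    multiplexed p q ∈ Matrix.unitaryGroup (Reg (Fin 2)) ℂ := by
  rw [Matrix.mem_unitaryGroup_iff]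
  ext x y
  rw [Matrix.mul_apply]
  have hs := sum_multiplexed_smul p q x fun z => star (multiplexed p q) z y
  simp only [smul_eq_mul] at hs
  rw [hs]
  by_cases hxy : x 1 = y 1
  · have hu := congrFun (congrFun (Matrix.mem_unitaryGroup_iff.mp (unitaryOfColumn_mem (h (x 1))))
      (x 0)) (y 0)
    rw [Matrix.mul_apply] at hu
    have : (1 : Matrix (Reg (Fin 2)) (Reg (Fin 2)) ℂ) x y =
        (1 : Matrix (Fin 2) (Fin 2) ℂ) (x 0) (y 0) := by
      rw [Matrix.one_apply, Matrix.one_apply]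
      congr 1
      refine propext ⟨fun h => by rw [h], fun h => ?_⟩
      funext k
      fin_cases k
      · exact h
      · exact hxy
    rw [this, ← hu]
    refine Finset.sum_congr rfl fun i _ => ?_
    simp [multiplexed, Matrix.star_apply, hxy]
  · rw [Matrix.one_apply_ne fun h => hxy (by rw [h])]
    refine Finset.sum_eq_zero fun i _ => ?_
    simp [multiplexed, Matrix.star_apply, Ne.symm hxy]

/-- The multiplexed unitary as a gate on the work qubits `0` and `1`. -/
noncomputable def multiplexedGate (p q : Fin 2 → ℂ) (h : ∀ e, ‖p e‖ ^ 2 + ‖q e‖ ^ 2 = 1) :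
    LocalGate (Fin 3) :=
  ⟨2, le_rfl, Fin.castSuccEmb, ⟨multiplexed p q, multiplexed_mem h⟩⟩

/-- The rotation of work qubit `1`. -/
noncomputable def selectGate (θ : ℝ) : LocalGate (Fin 3) :=
  ⟨1, by norm_num, ⟨fun _ => 1, fun _ _ _ => Subsingleton.elim _ _⟩,
    ⟨Circuit.rotation θ, Circuit.rotation_mem θ⟩⟩

variable {U : Matrix (Reg (Fin a ⊕ Fin s)) (Reg (Fin a ⊕ Fin s)) ℂ}

theorem branch_multiplexedGate_mul {p q : Fin 2 → ℂ} (h : ∀ e, ‖p e‖ ^ 2 + ‖q e‖ ^ 2 = 1)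
    (M : Matrix (Reg (Wires 3 a s)) (Reg (Wires 3 a s)) ℂ) (ω : Reg (Fin 3)) :
    branch ((Gate.work (multiplexedGate p q h) : Gate 3 a).eval U * M) ω =
      ∑ i, unitaryOfColumn (p (ω 1)) (q (ω 1)) (ω 0) i • branch M ![i, ω 1, ω 2] := by
  rw [branch_work_mul]
  refine (sum_multiplexed_smul p q (fun k => ω (Fin.castSuccEmb k)) _).trans ?_
  refine Finset.sum_congr rfl fun i _ => ?_
  congr 2
  funext k
  fin_cases k
  · exact extend_embedding_apply (Fin.castSuccEmb (n := 2)) _ ω 0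
  · exact extend_embedding_apply (Fin.castSuccEmb (n := 2)) _ ω 1
  · refine Function.extend_apply' _ _ _ ?_
    rintro ⟨k, hk⟩
    exact Fin.castSucc_ne_last k hk

theorem sum_rotation_smul {E : Type*} [AddCommGroup E] [Module ℂ E] (θ : ℝ) (x : Reg (Fin 1))
    (Ψ : Reg (Fin 1) → E) : ∑ z, Circuit.rotation θ x z • Ψ z =
      ∑ e, Circuit.rotation θ x (fun _ => e) • Ψ fun _ => e :=
  ((Equiv.funUnique (Fin 1) (Fin 2)).symm.sum_comp _).symm

theorem branch_selectGate_mul (θ : ℝ)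
    (M : Matrix (Reg (Wires 3 a s)) (Reg (Wires 3 a s)) ℂ) (ω : Reg (Fin 3)) :
    branch ((Gate.work (selectGate θ) : Gate 3 a).eval U * M) ω =
      ∑ e, Circuit.rotation θ (fun _ => ω 1) (fun _ => e) • branch M ![ω 0, e, ω 2] := by
  rw [branch_work_mul]
  refine (sum_rotation_smul θ (fun _ => ω 1) _).trans ?_
  refine Finset.sum_congr rfl fun e _ => ?_
  have hext : Function.extend (selectGate θ).wires (fun _ => e) ω = ![ω 0, e, ω 2] := by
    funext k
    fin_cases k
    · refine Function.extend_apply' _ _ _ ?_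
      rintro ⟨k, hk⟩
      exact absurd (hk : (1 : Fin 3) = 0) one_ne_zero
    · exact extend_embedding_apply (selectGate θ).wires _ ω (0 : Fin 1)
    · refine Function.extend_apply' _ _ _ ?_
      rintro ⟨k, hk⟩
      have h12 : (1 : Fin 3) = 2 := hk
      exact absurd h12 (by decide)
  exact congrArg (fun ω' => Circuit.rotation θ (fun _ => ω 1) (fun _ => e) • branch M ω') hext

/-- The state of the branches after `d` steps of two parallel signal processing sequences. -/
def IsSignalState (U : Matrix (Reg (Fin a ⊕ Fin s)) (Reg (Fin a ⊕ Fin s)) ℂ) (d : Fin 2 → ℕ)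
    (f : Fin 2 → Fin 2 → ℂ[X]) (M : Matrix (Reg (Wires 3 a s)) (Reg (Wires 3 a s)) ℂ) : Prop :=
  ∀ ω : Reg (Fin 3), branch M ω =
    -- Work qubit `2` is idle and stays `0`. The factor `1 / √2` is the amplitude of either value of
    -- the select qubit `1`.
    if ω 2 = 0 then ((Real.sqrt 2)⁻¹ : ℂ) • signalOp U (d (ω 1)) (f (ω 1) (ω 0)) else 0

theorem isSignalState_initial {p q : Fin 2 → ℂ} (h : ∀ e, ‖p e‖ ^ 2 + ‖q e‖ ^ 2 = 1)
    {f : Fin 2 → Fin 2 → ℂ[X]} (hf : ∀ e i, f e i = C (unitaryOfColumn (p e) (q e) i 0)) :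
    IsSignalState U (fun _ => 0) f (Circuit.eval U ([Gate.work (selectGate (Real.pi / 4)),
      Gate.work (multiplexedGate p q h)] : Circuit 3 a)) := by
  intro ω
  have hr : branch ((Gate.work (selectGate (Real.pi / 4)) : Gate 3 a).eval U) =
      fun ω : Reg (Fin 3) => if ω 2 = 0 ∧ ω 0 = 0 then ((Real.sqrt 2)⁻¹ : ℂ) • 1 else 0 := by
    funext ω
    rw [← mul_one (Gate.eval U _), branch_selectGate_mul, Fin.sum_univ_two, branch_one, branch_one]
    have h1 : (![ω 0, 1, ω 2] : Reg (Fin 3)) ≠ 0 := fun h => by simpa using congrFun h 1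
    have h0 : (![ω 0, 0, ω 2] : Reg (Fin 3)) = 0 ↔ ω 2 = 0 ∧ ω 0 = 0 := by
      simp [funext_iff, Fin.forall_fin_succ, and_comm]
    have hrot : Circuit.rotation (Real.pi / 4) (fun _ => ω 1) (fun _ => 0) =
        ((Real.sqrt 2)⁻¹ : ℂ) := by
      have h2 : (Real.sqrt 2 / 2 : ℝ) = (Real.sqrt 2)⁻¹ := by
        rw [Real.sqrt_div_self']
        simp
      rw [← Complex.ofReal_inv, ← h2]
      simp only [Circuit.rotation, Matrix.of_apply, Real.cos_pi_div_four, Real.sin_pi_div_four]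
      rcases Fin.exists_fin_two.mp ⟨ω 1, rfl⟩ with h | h <;> simp [h]
    rw [if_neg h1, smul_zero, add_zero, hrot]
    simp only [h0]
    split_ifs <;> simp
  simp only [Circuit.eval, one_mul]
  rw [branch_multiplexedGate_mul, hr, hf, signalOp_zero_C]
  rw [Fin.sum_univ_two]
  by_cases h2 : ω 2 = 0
  · simp [h2]
    rw [smul_comm]
  · simp [h2]

/-- One step of both sequences, or of the second one only if the call is controlled on qubit `1`. -/
noncomputable def signalStep (ctrl : Option (Fin 3)) (inv : Bool) (p q : Fin 2 → ℂ)
    (h : ∀ e, ‖p e‖ ^ 2 + ‖q e‖ ^ 2 = 1) : Circuit 3 a :=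
  [Gate.phase Real.pi ![some 0, ctrl.map fun _ => 1, none] true, Gate.call ctrl inv,
    Gate.phase Real.pi ![some 1, ctrl.map fun _ => 1, none] true,
    Gate.work (multiplexedGate p q h)]

theorem eval_signalStep_mul (ctrl : Option (Fin 3)) (inv : Bool) (p q : Fin 2 → ℂ)
    (h : ∀ e, ‖p e‖ ^ 2 + ‖q e‖ ^ 2 = 1) (M : Matrix (Reg (Wires 3 a s)) (Reg (Wires 3 a s)) ℂ) :
    Circuit.eval U (signalStep ctrl inv p q h) * M =
      (Gate.work (multiplexedGate p q h)).eval U *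
        ((Gate.phase Real.pi ![some 1, ctrl.map fun _ => 1, none] true).eval U *
          ((Gate.call ctrl inv).eval U *
            ((Gate.phase Real.pi ![some 0, ctrl.map fun _ => 1, none] true).eval U * M))) := by
  simp only [signalStep, Circuit.eval, one_mul, mul_assoc]

/-- The branch with qubit `0` equal to `0` is reflected before the call, which gives `X`. The other
branch is reflected after it, which gives `1`. -/
theorem branch_signalStep_none (hU : U ∈ Matrix.unitaryGroup (Reg (Fin a ⊕ Fin s)) ℂ) {d : ℕ}
    {g : Fin 2 → Fin 2 → ℂ[X]} {M : Matrix (Reg (Wires 3 a s)) (Reg (Wires 3 a s)) ℂ}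
    (hM : IsSignalState U (fun _ => d) g M) (ω : Reg (Fin 3)) :
    branch ((Gate.phase Real.pi ![some 1, none, none] true).eval U *
      ((Gate.call none d.bodd).eval U *
        ((Gate.phase Real.pi ![some 0, none, none] true).eval U * M))) ω =
    if ω 2 = 0 then ((Real.sqrt 2)⁻¹ : ℂ) •
      signalOp U (d + 1) (if ω 0 = 0 then X * g (ω 1) 0 else g (ω 1) 1) else 0 := by
  have hcond : ∀ c : Fin 2, (∀ q v, (![some c, none, none] : Fin 3 → Option (Fin 2)) q = some v →
      ω q = v) ↔ ω 0 = c := by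
    intro c
    simp only [Fin.forall_fin_succ (n := 2), Fin.forall_fin_two]
    fin_cases c <;> simp
  have hcall : (Gate.call none d.bodd : Gate 3 a).eval U =
      onQubits (callWires 3 a s) (alternatingCall U d) := rfl
  rw [hcall, branch_phase_mul, branch_onQubits_callWires_mul, branch_phase_mul, hM]
  simp only [hcond]
  rcases Fin.exists_fin_two.mp ⟨ω 0, rfl⟩ with h0 | h0
  · simp only [h0, zero_ne_one, if_true, if_false]
    split_ifs
    · rw [signalOp_succ_X_mul hU, Matrix.mul_smul, Matrix.mul_smul]
    · simp
  · simp only [h0, one_ne_zero, if_true, if_false]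
    split_ifs
    · rw [signalOp_succ, Matrix.mul_smul, Matrix.mul_smul]
    · simp

theorem branch_signalStep_some (hU : U ∈ Matrix.unitaryGroup (Reg (Fin a ⊕ Fin s)) ℂ) {d : ℕ}
    {g : Fin 2 → Fin 2 → ℂ[X]} {M : Matrix (Reg (Wires 3 a s)) (Reg (Wires 3 a s)) ℂ}
    (hM : IsSignalState U (fun _ => d) g M) (ω : Reg (Fin 3)) :
    branch ((Gate.phase Real.pi ![some 1, some 1, none] true).eval U *
      ((Gate.call (some 1) d.bodd).eval U *
        ((Gate.phase Real.pi ![some 0, some 1, none] true).eval U * M))) ω =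
    if ω 2 = 0 then ((Real.sqrt 2)⁻¹ : ℂ) •
      (if ω 1 = 1 then signalOp U (d + 1) (if ω 0 = 0 then X * g 1 0 else g 1 1)
        else signalOp U d (g 0 (ω 0))) else 0 := by
  have hcond : ∀ c : Fin 2, (∀ q v, (![some c, some 1, none] : Fin 3 → Option (Fin 2)) q = some v →
      ω q = v) ↔ ω 0 = c ∧ ω 1 = 1 := by
    intro c
    simp only [Fin.forall_fin_succ (n := 2), Fin.forall_fin_two]
    fin_cases c <;> simp
  have hcall : (Gate.call (some 1) d.bodd : Gate 3 a).eval U =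
      controlledOn (Sum.inl (Sum.inl 1)) (onQubits (callWires 3 a s) (alternatingCall U d)) := rfl
  rw [hcall, branch_phase_mul, branch_controlledOn_callWires_mul, branch_phase_mul, hM]
  simp only [hcond]
  rcases Fin.exists_fin_two.mp ⟨ω 1, rfl⟩ with h1 | h1
  · simp only [h1, zero_ne_one, and_false, if_false]
  rcases Fin.exists_fin_two.mp ⟨ω 0, rfl⟩ with h0 | h0
  · simp only [h0, h1, zero_ne_one, and_true, if_true, if_false]
    split_ifs
    · rw [signalOp_succ_X_mul hU, Matrix.mul_smul, Matrix.mul_smul]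
    · simp
  · simp only [h0, h1, one_ne_zero, and_true, if_true, if_false]
    split_ifs
    · rw [signalOp_succ, Matrix.mul_smul, Matrix.mul_smul]
    · simp

theorem signalOp_C_mul (j : ℕ) (z : ℂ) (f : ℂ[X]) :
    signalOp U j (C z * f) = z • signalOp U j f := by
  rw [← smul_eq_C_mul, map_smul]

theorem IsSignalState.step (hU : U ∈ Matrix.unitaryGroup (Reg (Fin a ⊕ Fin s)) ℂ) {d : ℕ}
    {p q : Fin 2 → ℂ} (h : ∀ e, ‖p e‖ ^ 2 + ‖q e‖ ^ 2 = 1) {f g : Fin 2 → Fin 2 → ℂ[X]}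
    (hf : ∀ e i, f e i = C (unitaryOfColumn (p e) (q e) i 0) * (X * g e 0) +
      C (unitaryOfColumn (p e) (q e) i 1) * g e 1)
    {M : Matrix (Reg (Wires 3 a s)) (Reg (Wires 3 a s)) ℂ} (hM : IsSignalState U (fun _ => d) g M) :
    IsSignalState U (fun _ => d + 1) f
      (Circuit.eval U (signalStep none d.bodd p q h) * M) := by
  intro ω
  rw [eval_signalStep_mul, branch_multiplexedGate_mul, Fin.sum_univ_two, Option.map_none,
    branch_signalStep_none hU hM, branch_signalStep_none hU hM, hf, map_add, signalOp_C_mul,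
    signalOp_C_mul]
  by_cases h2 : ω 2 = 0
  · simp [h2]
    module
  · simp [h2]

/-- The first sequence is frozen: its call and its reflections are controlled away, and the column
`(1, 0)` makes its one-qubit unitary the identity. -/
theorem IsSignalState.step_second (hU : U ∈ Matrix.unitaryGroup (Reg (Fin a ⊕ Fin s)) ℂ) {d : ℕ}
    {p q : Fin 2 → ℂ} (h : ∀ e, ‖p e‖ ^ 2 + ‖q e‖ ^ 2 = 1) (hp : p 0 = 1) (hq : q 0 = 0)
    {f g : Fin 2 → Fin 2 → ℂ[X]} (hf0 : f 0 = g 0)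
    (hf : ∀ i, f 1 i = C (unitaryOfColumn (p 1) (q 1) i 0) * (X * g 1 0) +
      C (unitaryOfColumn (p 1) (q 1) i 1) * g 1 1)
    {M : Matrix (Reg (Wires 3 a s)) (Reg (Wires 3 a s)) ℂ} (hM : IsSignalState U (fun _ => d) g M) :
    IsSignalState U ![d, d + 1] f
      (Circuit.eval U (signalStep (some 1) d.bodd p q h) * M) := by
  intro ω
  rw [eval_signalStep_mul, branch_multiplexedGate_mul, Fin.sum_univ_two, Option.map_some,
    branch_signalStep_some hU hM, branch_signalStep_some hU hM]
  by_cases h2 : ω 2 = 0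
  · rcases Fin.exists_fin_two.mp ⟨ω 1, rfl⟩ with h1 | h1
    · rcases Fin.exists_fin_two.mp ⟨ω 0, rfl⟩ with h0 | h0 <;>
        simp [h2, h1, h0, hp, hq, hf0, unitaryOfColumn]
    · simp only [h1, hf, map_add, signalOp_C_mul]
      simp [h2]
      module
  · simp [h2]

/-- Two parallel signal processing sequences for given pairs of polynomials. -/
theorem exists_circuit_of_isUnitPair (a d : ℕ) : ∀ f : Fin 2 → Fin 2 → ℂ[X],
    (∀ e, IsUnitPair d (f e)) → ∃ c : Circuit 3 a, c.calls = d ∧ c.otherGates = 3 * d + 2 ∧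
      ∀ (s : ℕ) (U : Matrix (Reg (Fin a ⊕ Fin s)) (Reg (Fin a ⊕ Fin s)) ℂ),
        U ∈ Matrix.unitaryGroup (Reg (Fin a ⊕ Fin s)) ℂ →
        IsSignalState U (fun _ => d) f (Circuit.eval U c) := by
  induction d with
  | zero =>
    intro f hf
    choose p q hpq hfpq using fun e => (hf e).exists_eq_zero
    exact ⟨[Gate.work (selectGate (Real.pi / 4)), Gate.work (multiplexedGate p q hpq)],
      by simp [Circuit.calls, Gate.isCall], by simp [Circuit.otherGates, Gate.isCall],
      fun s U _ => isSignalState_initial hpq hfpq⟩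
  | succ d ih =>
    intro f hf
    choose p q g hpq hg hfpq using fun e => (hf e).exists_eq_succ
    obtain ⟨c, hc1, hc2, hc⟩ := ih g hg
    refine ⟨c ++ signalStep none d.bodd p q hpq, ?_, ?_, fun s U hU => ?_⟩
    · rw [Circuit.calls_append, hc1]
      simp [Circuit.calls, signalStep, Gate.isCall]
    · rw [Circuit.otherGates_append, hc2]
      simp [Circuit.otherGates, signalStep, Gate.isCall]
      ring
    · rw [Circuit.eval_append]
      exact (hc s U hU).step hU hpq hfpq

/-- A circuit for the sum of two signal processing sequences of lengths `d` and `d + 1`. -/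
theorem exists_circuit_of_norm_lt_one (a d : ℕ) {P Q : ℂ[X]} (hPd : P.natDegree ≤ d)
    (hQd : Q.natDegree ≤ d + 1) (hP : ∀ w : ℂ, ‖w‖ = 1 → ‖P.eval w‖ < 1)
    (hQ : ∀ w : ℂ, ‖w‖ = 1 → ‖Q.eval w‖ < 1) :
    ∃ c : Circuit 3 a, c.calls = d + 1 ∧ c.otherGates = 3 * d + 6 ∧
      ∀ (s : ℕ) (U : Matrix (Reg (Fin a ⊕ Fin s)) (Reg (Fin a ⊕ Fin s)) ℂ),
        U ∈ Matrix.unitaryGroup (Reg (Fin a ⊕ Fin s)) ℂ →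
        zeroBlock (Circuit.eval U c) = (1 / 2 : ℂ) •
          (zeroBlock (signalOp U d P) + zeroBlock (signalOp U (d + 1) Q)) := by
  obtain ⟨P', hP'd, hP'⟩ := exists_complementary hPd hP
  obtain ⟨Q', hQ'd, hQ'⟩ := exists_complementary hQd hQ
  have hunitQ : IsUnitPair (d + 1) ![Q, Q'] :=
    ⟨fun i => by fin_cases i <;> assumption, hQ'⟩
  have hunitP : IsUnitPair d ![P, P'] := ⟨fun i => by fin_cases i <;> assumption, hP'⟩
  -- The last layer of the longer sequence is removed first. Both remaining pairs then have degree
  -- `d` and share `d` uncontrolled calls.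
  obtain ⟨p, q, g, hpq, hg, hf⟩ := hunitQ.exists_eq_succ
  obtain ⟨c, hc1, hc2, hc⟩ := exists_circuit_of_isUnitPair a d ![![P, P'], g] fun e => by
    fin_cases e <;> assumption
  have hpq' : ∀ e : Fin 2, ‖(![1, p] : Fin 2 → ℂ) e‖ ^ 2 + ‖(![0, q] : Fin 2 → ℂ) e‖ ^ 2 = 1 := by
    intro e
    fin_cases e
    · simp
    · exact hpq
  refine ⟨c ++ signalStep (some 1) d.bodd ![1, p] ![0, q] hpq' ++
    [Gate.work (selectGate (-(Real.pi / 4)))], ?_, ?_, fun s U hU => ?_⟩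
  · rw [Circuit.calls_append, Circuit.calls_append, hc1]
    simp [Circuit.calls, signalStep, Gate.isCall]
  · rw [Circuit.otherGates_append, Circuit.otherGates_append, hc2]
    simp [Circuit.otherGates, signalStep, Gate.isCall]
  · have hstate := (hc s U hU).step_second hU hpq' rfl rfl (g := ![![P, P'], g])
      (f := ![![P, P'], ![Q, Q']]) rfl hf
    rw [Circuit.eval_append, Circuit.eval_singleton, Circuit.eval_append, ← zeroBlock_branch_zero,
      branch_selectGate_mul, Fin.sum_univ_two, hstate, hstate]
    have h2 : ((Real.sqrt 2 : ℝ) : ℂ) * (Real.sqrt 2 : ℝ) = 2 := by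
      rw [← Complex.ofReal_mul, Real.mul_self_sqrt (by norm_num)]
      norm_num
    have h3 : ((Real.sqrt 2 : ℝ) : ℂ) ≠ 0 := by
      intro h
      rw [h] at h2
      norm_num at h2
    -- The row `⟨0|` of the final rotation is `(1, 1) / √2`. With the initial `1 / √2` this gives
    -- the factor `1 / 2` in front of the sum.
    have hrot : ∀ e : Fin 2, Circuit.rotation (-(Real.pi / 4))
        (fun _ => (0 : Reg (Fin 3)) 1) (fun _ => e) = ((Real.sqrt 2)⁻¹ : ℂ) := by
      intro e
      have h4 : (Real.sqrt 2 : ℂ) / 2 = (Real.sqrt 2 : ℂ)⁻¹ := by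
        field_simp
        rw [sq, h2]
      rw [← h4]
      simp only [Circuit.rotation, Matrix.of_apply, Real.cos_neg, Real.sin_neg,
        Real.cos_pi_div_four, Real.sin_pi_div_four]
      fin_cases e <;> simp
    have h5 : ((Real.sqrt 2 : ℝ) : ℂ)⁻¹ * ((Real.sqrt 2 : ℝ) : ℂ)⁻¹ = 1 / 2 := by
      rw [← mul_inv, h2]
      norm_num
    rw [hrot, hrot]
    simp only [Matrix.cons_val_zero, Matrix.cons_val_one, Matrix.cons_val, if_true, Pi.zero_apply,
      smul_smul, h5, zeroBlock_add, zeroBlock_smul, smul_add]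

end TwoSequences

/-! ### Truncated exponential series -/

section Taylor

open Polynomial

/-- The tail is dominated by a geometric series of ratio `τ / (n + 1) ≤ 1 / 5`, whose sum is `5 / 4`
of its first term. -/
theorem norm_exp_sub_sum_le {𝔸 : Type*} [NormedRing 𝔸] [NormedAlgebra ℂ 𝔸] [CompleteSpace 𝔸]
    {x : 𝔸} {τ : ℝ} (hx : ‖x‖ ≤ τ) {n : ℕ} (hn : 0 < n) (hτ : 5 * τ ≤ n + 1) :
    ‖NormedSpace.exp x - ∑ k ∈ Finset.range n, ((k.factorial : ℂ)⁻¹) • x ^ k‖ ≤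
      5 / 4 * (τ ^ n / n.factorial) := by
  have hτ0 : 0 ≤ τ := (norm_nonneg _).trans hx
  have hs := NormedSpace.exp_series_hasSum_exp' (𝕂 := ℂ) x
  have hs' := (hasSum_nat_add_iff' n).mpr hs
  have hgeom := (hasSum_geometric_of_lt_one (r := (1 / 5 : ℝ)) (by norm_num)
    (by norm_num)).mul_left (τ ^ n / n.factorial)
  rw [← hs'.tsum_eq]
  refine (tsum_of_norm_bounded hgeom fun i => ?_).trans (le_of_eq ?_)
  · rw [norm_smul, norm_inv, Complex.norm_natCast]
    have h1 : ‖x ^ (i + n)‖ ≤ τ ^ (i + n) :=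
      (norm_pow_le' x (by omega)).trans (pow_le_pow_left₀ (norm_nonneg _) hx _)
    have h2 : (n.factorial * (n + 1) ^ i : ℝ) ≤ ((i + n).factorial : ℝ) := by
      rw [add_comm i n]
      exact_mod_cast Nat.factorial_mul_pow_le_factorial
    have h3 : (0 : ℝ) < n.factorial := by exact_mod_cast n.factorial_pos
    have h4 : (5 * τ) ^ i ≤ (n + 1 : ℝ) ^ i := pow_le_pow_left₀ (by positivity) hτ i
    calc (((i + n).factorial : ℝ))⁻¹ * ‖x ^ (i + n)‖
        ≤ (n.factorial * (n + 1) ^ i : ℝ)⁻¹ * τ ^ (i + n) := by gcongr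
      _ ≤ τ ^ n / n.factorial * (1 / 5) ^ i := by
        rw [inv_mul_eq_div, div_mul_eq_mul_div, div_le_div_iff₀ (by positivity) h3, pow_add]
        have h5 : τ ^ i ≤ (1 / 5) ^ i * (n + 1) ^ i := by
          rw [mul_pow] at h4
          rw [one_div, inv_pow, inv_mul_eq_div, le_div_iff₀ (by positivity)]
          linarith
        have h6 : 0 ≤ τ ^ n * (n.factorial : ℝ) := by positivity
        nlinarith
  · norm_num
    ring

/-- The sequence decreases: the ratio of successive terms is `(1 + 1 / n) ^ n / 5.6`, at most `e /
5.6`. At `n = 2` the value is about `0.064`. -/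
theorem pow_div_factorial_le {n : ℕ} (hn : 2 ≤ n) :
    ((n : ℝ) / 5.6) ^ n / n.factorial ≤ 1 / 10 := by
  induction n, hn using Nat.le_induction with
  | base => norm_num [Nat.factorial]
  | succ n hn ih =>
    refine le_trans ?_ ih
    have hn0 : (0 : ℝ) < n := by exact_mod_cast (by omega : 0 < n)
    have h1 : ((n : ℝ) + 1) ^ n ≤ 5.6 * (n : ℝ) ^ n := by
      have h2 : ((n : ℝ) + 1) / n ≤ Real.exp (1 / n) := by
        have := Real.add_one_le_exp (1 / (n : ℝ))
        rw [add_div, div_self hn0.ne']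
        linarith
      have h3 := pow_le_pow_left₀ (by positivity) h2 n
      rw [← Real.exp_nat_mul, mul_one_div_cancel hn0.ne', div_pow, div_le_iff₀ (by positivity)] at h3
      have h4 := Real.exp_one_lt_d9
      have h5 : (0 : ℝ) < (n : ℝ) ^ n := by positivity
      nlinarith
    have h6 : (0 : ℝ) < n.factorial := by exact_mod_cast n.factorial_pos
    rw [Nat.factorial_succ]
    push_cast
    rw [div_pow, div_pow, div_div, div_div, div_le_div_iff₀ (by positivity) (by positivity),
      pow_succ, pow_succ]
    have h7 : (0 : ℝ) < (n + 1) * 5.6 ^ n * n.factorial := by positivity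
    nlinarith [mul_le_mul_of_nonneg_left h1 h7.le]

/-- The truncation error for `2 R` terms with `R ≥ 2.8 τ + log (1 / ε)`. -/
theorem truncation_error_le {τ ε : ℝ} (hτ : 0 ≤ τ) (hε : 0 < ε) (hε1 : ε < 1) {R : ℕ}
    (hR : 0 < R) (h : 2.8 * τ + Real.log (1 / ε) ≤ R) :
    5 / 4 * (τ ^ (2 * R) / (2 * R).factorial) ≤ ε / 8 := by
  have hR0 : (0 : ℝ) < R := by exact_mod_cast hR
  have hlog : Real.log (1 / ε) = -Real.log ε := by rw [one_div, Real.log_inv]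
  rw [hlog] at h
  -- By `1 + x ≤ exp x` with `x = log ε / R`, the hypothesis gives `2.8 τ ≤ R ε ^ (1 / R)`. The
  -- power `2 R` turns the last factor into `ε²`, and `5 / 4 * (1 / 10) = 1 / 8`.
  have h1 : τ ≤ ((2 * R : ℕ) : ℝ) / 5.6 * Real.exp (Real.log ε / R) := by
    have h2 := Real.add_one_le_exp (Real.log ε / R)
    have h3 : (Real.log ε / R + 1) * R = Real.log ε + R := by field_simp
    have h4 : (Real.log ε / R + 1) * R ≤ Real.exp (Real.log ε / R) * R := by gcongr
    push_cast
    rw [show 2 * (R : ℝ) / 5.6 * Real.exp (Real.log ε / R) =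
      Real.exp (Real.log ε / R) * R / 2.8 by ring, le_div_iff₀ (by norm_num)]
    linarith
  have h5 := pow_le_pow_left₀ hτ h1 (2 * R)
  rw [mul_pow, ← Real.exp_nat_mul] at h5
  have h6 : Real.exp (((2 * R : ℕ) : ℝ) * (Real.log ε / R)) = ε ^ 2 := by
    rw [show ((2 * R : ℕ) : ℝ) * (Real.log ε / R) = Real.log ε + Real.log ε by
      push_cast; field_simp; ring, Real.exp_add, Real.exp_log hε, sq]
  rw [h6] at h5
  have h7 := pow_div_factorial_le (n := 2 * R) (by omega)
  have h8 : (0 : ℝ) < ((2 * R).factorial : ℝ) := by exact_mod_cast Nat.factorial_pos _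
  have h9 : τ ^ (2 * R) / (2 * R).factorial ≤ 1 / 10 * ε ^ 2 := by
    refine le_trans ?_ (mul_le_mul_of_nonneg_right h7 (sq_nonneg ε))
    rw [div_mul_eq_mul_div]
    gcongr
  nlinarith

theorem sum_range_even_add_odd {E : Type*} [AddCommMonoid E] (f : ℕ → E) (n : ℕ) :
    ∑ j ∈ Finset.range n, f (2 * j) + ∑ j ∈ Finset.range n, f (2 * j + 1) =
      ∑ k ∈ Finset.range (2 * n), f k := by
  induction n with
  | zero => simp
  | succ n ih =>
    rw [show 2 * (n + 1) = 2 * n + 1 + 1 by ring, Finset.sum_range_succ _ (2 * n + 1),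
      Finset.sum_range_succ _ (2 * n), ← ih, Finset.sum_range_succ, Finset.sum_range_succ]
    abel

/-- The polynomial whose signal processing sequence encodes the even (`e = 0`) or odd (`e = 1`)
part of the truncated exponential series. -/
noncomputable def seriesPoly (κ y : ℂ) (l e : ℕ) : ℂ[X] :=
  ∑ j ∈ Finset.range (l + 1), C (κ * ((2 * j + e).factorial : ℂ)⁻¹ * y ^ (2 * j + e)) *
    -- The factor `X ^ (l - j)` adds `2 (l - j)` steps, so every term has length `2 l + e`.
    (X ^ (l - j) * (C (1 / 2) * (X + 1)) ^ (2 * j + e))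

theorem natDegree_seriesPoly_le (κ y : ℂ) (l e : ℕ) :
    (seriesPoly κ y l e).natDegree ≤ 2 * l + e := by
  refine natDegree_sum_le_of_forall_le _ _ fun j hj => ?_
  rw [Finset.mem_range] at hj
  have h1 : (C (1 / 2 : ℂ) * (X + 1)).natDegree ≤ 1 :=
    (natDegree_C_mul_le _ _).trans (natDegree_X_add_C (1 : ℂ)).le
  have h2 : ((C (1 / 2 : ℂ) * (X + 1)) ^ (2 * j + e)).natDegree ≤ (2 * j + e) * 1 :=
    natDegree_pow_le_of_le _ h1
  refine (natDegree_C_mul_le _ _).trans (natDegree_mul_le.trans ?_)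
  rw [natDegree_X_pow]
  omega

/-- With `w = z²` one has `(w + 1) / 2 = z * Re z`. Up to the phase `z ^ (2 l + e)`, the polynomial
is then `κ` times the truncated cosine or `i` sine at `τ Re z`. The truncated exponential has norm
at most `9 / 8` at `±i τ Re z`, hence so do its even and odd parts. -/
theorem norm_eval_seriesPoly_lt {κ : ℂ} (hκ : ‖κ‖ ≤ 1 / 2) {τ : ℝ} (hτ : 0 ≤ τ) {l e : ℕ}
    (he : e < 2) (hτl : 5 * τ ≤ 2 * (l + 1))
    (herr : 5 / 4 * (τ ^ (2 * (l + 1)) / (2 * (l + 1)).factorial) ≤ 1 / 8) {w : ℂ} (hw : ‖w‖ = 1) :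
    ‖(seriesPoly κ (Complex.I * τ) l e).eval w‖ < 1 := by
  obtain ⟨z, hz⟩ := IsAlgClosed.exists_pow_nat_eq w (n := 2) (by norm_num)
  have hz1 : ‖z‖ = 1 := by
    have : ‖z‖ ^ 2 = 1 := by rw [← norm_pow, hz, hw]
    nlinarith [norm_nonneg z]
  have hzz : z * starRingEnd ℂ z = 1 := by
    rw [mul_conj_eq_norm_sq, hz1]
    simp
  have hre : ((z.re : ℝ) : ℂ) = (z + starRingEnd ℂ z) / 2 := Complex.re_eq_add_conj z
  set v : ℂ := Complex.I * ((τ * z.re : ℝ) : ℂ) with hv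
  have heval : (seriesPoly κ (Complex.I * τ) l e).eval w = κ * z ^ (2 * l + e) *
      ∑ j ∈ Finset.range (l + 1), ((2 * j + e).factorial : ℂ)⁻¹ * v ^ (2 * j + e) := by
    rw [seriesPoly, eval_finsetSum, Finset.mul_sum]
    refine Finset.sum_congr rfl fun j hj => ?_
    rw [Finset.mem_range] at hj
    simp only [eval_mul, eval_C, eval_pow, eval_X, eval_add, eval_one]
    have h1 : (1 / 2 : ℂ) * (w + 1) = z * z.re := by
      rw [hre, ← hz]
      linear_combination (-1 / 2 : ℂ) * hzz
    have h2 : z ^ (2 * l + e) = w ^ (l - j) * z ^ (2 * j + e) := by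
      rw [← hz, ← pow_mul, ← pow_add]
      congr 1
      omega
    rw [h1, h2, hv, Complex.ofReal_mul]
    simp only [mul_pow]
    ring
  have hnorm : ∀ r : ℝ, |r| ≤ τ →
      ‖∑ k ∈ Finset.range (2 * (l + 1)), ((k.factorial : ℂ)⁻¹) * (Complex.I * r) ^ k‖ ≤ 9 / 8 := by
    intro r hr
    have h1 := norm_exp_sub_sum_le (x := Complex.I * (r : ℂ)) (τ := τ)
      (by simpa [norm_mul] using hr) (n := 2 * (l + 1)) (by omega)
      (by push_cast; linarith)
    have h2 : ‖NormedSpace.exp (Complex.I * (r : ℂ))‖ = 1 := by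
      rw [← Complex.exp_eq_exp_ℂ, mul_comm, Complex.norm_exp_ofReal_mul_I]
    simp only [smul_eq_mul] at h1
    have h3 := norm_sub_norm_le
      (∑ k ∈ Finset.range (2 * (l + 1)), ((k.factorial : ℂ)⁻¹) * (Complex.I * r) ^ k)
      (NormedSpace.exp (Complex.I * (r : ℂ)))
    rw [norm_sub_rev, h2] at h3
    linarith
  have hx : |τ * z.re| ≤ τ := by
    rw [abs_mul, abs_of_nonneg hτ]
    have := Complex.abs_re_le_norm z
    rw [hz1] at this
    nlinarith
  have hpos := hnorm (τ * z.re) hx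
  have hneg := hnorm (-(τ * z.re)) (by rwa [abs_neg])
  rw [← sum_range_even_add_odd] at hpos hneg
  rw [← hv] at hpos
  have hv' : Complex.I * ((-(τ * z.re) : ℝ) : ℂ) = -v := by rw [hv]; push_cast; ring
  rw [hv'] at hneg
  simp only [(even_two_mul _).neg_pow, (odd_two_mul_add_one _).neg_pow, mul_neg,
    Finset.sum_neg_distrib] at hneg
  have hsum : ‖∑ j ∈ Finset.range (l + 1), ((2 * j + e).factorial : ℂ)⁻¹ * v ^ (2 * j + e)‖ ≤
      9 / 8 := by
    have hhalf : ∀ p q : ℂ, ‖p + q‖ ≤ 9 / 8 → ‖p + -q‖ ≤ 9 / 8 → ‖p‖ ≤ 9 / 8 ∧ ‖q‖ ≤ 9 / 8 := by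
      intro p q h1 h2
      constructor
      · have h3 := norm_add_le (p + q) (p + -q)
        rw [show p + q + (p + -q) = (2 : ℂ) * p by ring, norm_mul] at h3
        norm_num at h3
        linarith
      · have h3 := norm_sub_le (p + q) (p + -q)
        rw [show p + q - (p + -q) = (2 : ℂ) * q by ring, norm_mul] at h3
        norm_num at h3
        linarith
    have h := hhalf _ _ hpos hneg
    interval_cases e
    · exact h.1
    · exact h.2
  rw [heval, norm_mul, norm_mul, norm_pow, hz1, one_pow, mul_one]
  nlinarith [norm_nonneg κ, norm_nonneg (∑ j ∈ Finset.range (l + 1),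
    ((2 * j + e).factorial : ℂ)⁻¹ * v ^ (2 * j + e))]

theorem zeroBlock_signalOp_seriesPoly {a s : ℕ}
    {U : Matrix (Reg (Fin a ⊕ Fin s)) (Reg (Fin a ⊕ Fin s)) ℂ}
    (hU : U ∈ Matrix.unitaryGroup (Reg (Fin a ⊕ Fin s)) ℂ)
    {H : Matrix (Reg (Fin s)) (Reg (Fin s)) ℂ} (hH : H.IsHermitian) {α : ℝ}
    (hblock : (α : ℂ) • zeroBlock U = H) (κ t : ℂ) (l e : ℕ) :
    zeroBlock (signalOp U (2 * l + e) (seriesPoly κ (t * α) l e)) = κ •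
      ∑ j ∈ Finset.range (l + 1), ((2 * j + e).factorial : ℂ)⁻¹ • ((-t) • H) ^ (2 * j + e) := by
  rw [seriesPoly, map_sum, zeroBlock_sum, Finset.smul_sum]
  refine Finset.sum_congr rfl fun j hj => ?_
  rw [Finset.mem_range] at hj
  rw [signalOp_C_mul, zeroBlock_smul, show 2 * l + e = 2 * j + e + 2 * (l - j) by omega,
    signalOp_add_X_pow_mul hU, ← smul_zeroBlock_signalOp hU hH hblock, smul_smul, smul_smul]

end Taylor

/-! ### Simulation of coupled oscillators -/

section Simulation

theorem evolution_mem_unitaryGroup {ι : Type} [Fintype ι] [DecidableEq ι]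
    {H : Matrix (Reg ι) (Reg ι) ℂ} (hH : H.IsHermitian) (t : ℝ) :
    NormedSpace.exp ((-(Complex.I * t)) • H) ∈ Matrix.unitaryGroup (Reg ι) ℂ := by
  rw [Matrix.mem_unitaryGroup_iff, Matrix.star_eq_conjTranspose, ← Matrix.exp_conjTranspose,
    Matrix.conjTranspose_smul, hH]
  have e : star (-(Complex.I * t)) • H = -((-(Complex.I * t)) • H) := by
    rw [← neg_smul]
    congr 1
    simp
  rw [e, ← Matrix.exp_add_of_commute _ _
    (Commute.neg_right (Commute.refl ((-(Complex.I * t)) • H))), add_neg_cancel,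
    NormedSpace.exp_zero]

/-- The truncation error is measured in operator norm, so the series is summed among operators and
carried back by the inverse isomorphism, which is continuous in finite dimension. -/
theorem toEuclideanCLM_exp {ι : Type} [Fintype ι] [DecidableEq ι]
    (M : Matrix (Reg ι) (Reg ι) ℂ) :
    Matrix.toEuclideanCLM (𝕜 := ℂ) (NormedSpace.exp M) =
      NormedSpace.exp (Matrix.toEuclideanCLM (𝕜 := ℂ) M) := by
  let T := Matrix.toEuclideanCLM (n := Reg ι) (𝕜 := ℂ)
  have hc : Continuous T.symm :=
    LinearMap.continuous_of_finiteDimensional (T.symm.toAlgEquiv.toLinearMap)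
  have h := (NormedSpace.exp_series_hasSum_exp' (𝕂 := ℂ) (T M)).map T.symm hc
  have e : (T.symm ∘ fun n : ℕ => ((n.factorial : ℂ)⁻¹) • T M ^ n) =
      fun n : ℕ => ((n.factorial : ℂ)⁻¹) • M ^ n := by
    funext n
    simp only [Function.comp_apply, ← map_pow, ← map_smul, StarAlgEquiv.symm_apply_apply]
  rw [e] at h
  have hM : NormedSpace.exp M = T.symm (NormedSpace.exp (T M)) :=
    (congrFun (NormedSpace.exp_eq_tsum ℂ) M).trans h.tsum_eq
  rw [hM]
  exact T.apply_symm_apply _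

/-- The error `ε / 8` leaves room for the factor `4` of amplification and for the normalization of
the output. -/
theorem exists_evolution_circuit {a s : ℕ}
    {U : Matrix (Reg (Fin a ⊕ Fin s)) (Reg (Fin a ⊕ Fin s)) ℂ}
    (hU : U ∈ Matrix.unitaryGroup (Reg (Fin a ⊕ Fin s)) ℂ)
    {H : Matrix (Reg (Fin s)) (Reg (Fin s)) ℂ} (hH : H.IsHermitian) {α : ℝ} (hα : 0 ≤ α)
    (hblock : (α : ℂ) • zeroBlock U = H) {t : ℝ} (ht : 0 ≤ t) {ε : ℝ} (hε : 0 < ε) (hε1 : ε < 1)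
    {β : ℝ} (hβ : 4 ≤ β) {l : ℕ} (hl : 2.8 * α * t + Real.log (1 / ε) ≤ (l + 1 : ℕ)) :
    ∃ V : Circuit 3 a, V.calls = 2 * l + 1 ∧ V.otherGates = 6 * l + 6 ∧
      IsBlockEncoding β (ε / 8) (V.eval U) (NormedSpace.exp ((-(Complex.I * t)) • H)) := by
  set τ : ℝ := α * t with hτdef
  have hτ : 0 ≤ τ := mul_nonneg hα ht
  have hlog : 0 ≤ Real.log (1 / ε) :=
    Real.log_nonneg (by rw [le_div_iff₀ hε]; linarith)
  have hl' : 2.8 * τ + Real.log (1 / ε) ≤ (l + 1 : ℕ) := by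
    rw [hτdef, ← mul_assoc]
    exact hl
  have herr : 5 / 4 * (τ ^ (2 * (l + 1)) / (2 * (l + 1)).factorial) ≤ ε / 8 :=
    truncation_error_le hτ hε hε1 (Nat.succ_pos l) hl'
  have hβ0 : (β : ℂ) ≠ 0 := by
    have : β ≠ 0 := by linarith
    exact_mod_cast this
  have hκ : ‖(2 / β : ℂ)‖ ≤ 1 / 2 := by
    rw [norm_div, Complex.norm_real, Real.norm_eq_abs, abs_of_nonneg (by linarith),
      Complex.norm_ofNat, div_le_div_iff₀ (by linarith) (by norm_num)]
    linarith
  have h5τ : 5 * τ ≤ 2 * (l + 1 : ℝ) := by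
    push_cast at hl'
    linarith
  -- The scale `2 / β` compensates the factor `1 / 2` of the superposition, so the block is exactly
  -- the truncated series over `β`. The requirement `β ≥ 4` keeps both polynomials below one in
  -- modulus.
  obtain ⟨V, hV1, hV2, hV⟩ := exists_circuit_of_norm_lt_one a (2 * l)
    (natDegree_seriesPoly_le (2 / β) (Complex.I * τ) l 0)
    (natDegree_seriesPoly_le (2 / β) (Complex.I * τ) l 1)
    (fun w hw => norm_eval_seriesPoly_lt hκ hτ (by norm_num) h5τ (by linarith) hw)
    (fun w hw => norm_eval_seriesPoly_lt hκ hτ (by norm_num) h5τ (by linarith) hw)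
  refine ⟨V, hV1, by rw [hV2]; ring, V.eval_mem_unitaryGroup hU, by linarith, ?_⟩
  have hy : Complex.I * (τ : ℂ) = Complex.I * t * α := by
    rw [hτdef, Complex.ofReal_mul]
    ring
  have hsum : (β : ℂ) • zeroBlock (V.eval U) = ∑ k ∈ Finset.range (2 * (l + 1)),
      ((k.factorial : ℂ)⁻¹) • ((-(Complex.I * t)) • H) ^ k := by
    have h0 := zeroBlock_signalOp_seriesPoly hU hH hblock (2 / β) (Complex.I * t) l 0
    have h1 := zeroBlock_signalOp_seriesPoly hU hH hblock (2 / β) (Complex.I * t) l 1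
    simp only [add_zero] at h0
    rw [hV s U hU, hy, h0, h1, ← smul_add, sum_range_even_add_odd fun k =>
      ((k.factorial : ℂ)⁻¹) • ((-(Complex.I * t)) • H) ^ k, smul_smul, smul_smul]
    have : (β : ℂ) * (1 / 2 * (2 / β)) = 1 := by field_simp
    rw [← mul_assoc] at this
    rw [this, one_smul]
  -- `H` is `α` times a compression of a unitary, so its norm is at most `α`.
  have hnorm : ‖Matrix.toEuclideanCLM (𝕜 := ℂ) ((-(Complex.I * t)) • H)‖ ≤ τ := by
    have h1 : ‖Matrix.toEuclideanCLM (𝕜 := ℂ) (zeroBlock U)‖ ≤ 1 := specNorm_zeroBlock_le_one hU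
    rw [← hblock, map_smul, map_smul, norm_smul, norm_smul, norm_neg, norm_mul, Complex.norm_I,
      Complex.norm_real, Complex.norm_real, Real.norm_eq_abs, Real.norm_eq_abs, abs_of_nonneg hα,
      abs_of_nonneg ht, one_mul, hτdef]
    nlinarith [mul_le_mul_of_nonneg_left h1 hτ]
  have key := norm_exp_sub_sum_le hnorm (n := 2 * (l + 1)) (by omega) (by push_cast; linarith)
  rw [specNorm, hsum, map_sub, map_sum, toEuclideanCLM_exp]
  simp only [map_smul, map_pow] at key ⊢
  exact key.trans herr

theorem OscillatorChain.hamiltonian_isHermitian {N : ℕ} (c : OscillatorChain N) :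
    c.hamiltonian.IsHermitian := by
  ext x y
  simp only [hamiltonian, Matrix.conjTranspose_apply, Matrix.neg_apply, Matrix.of_apply, star_neg,
    star_add]
  rw [add_comm]
  congr 2
  · by_cases h : y 0 = 1 ∧ x 0 = 0
    · rw [if_pos h, if_pos h.symm, star_star]
    · rw [if_neg h, if_neg fun h' => h h'.symm, star_zero]
  · by_cases h : y 0 = 0 ∧ x 0 = 1
    · rw [if_pos h, if_pos h.symm]
    · rw [if_neg h, if_neg fun h' => h h'.symm, star_zero]

theorem norm_normalized {ι : Type} [Fintype ι] [DecidableEq ι] {ψ : QState ι} (h : ψ ≠ 0) :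
    ‖normalized ψ‖ = 1 := by
  rw [normalized, norm_smul, Complex.norm_real, norm_inv, norm_norm,
    inv_mul_cancel₀ (norm_ne_zero_iff.mpr h)]

theorem norm_normalized_sub {ι : Type} [Fintype ι] [DecidableEq ι] {ψ : QState ι} (h : ψ ≠ 0) :
    ‖normalized ψ - ψ‖ = |1 - ‖ψ‖| := by
  have h0 : ‖ψ‖ ≠ 0 := norm_ne_zero_iff.mpr h
  have e : normalized ψ - ψ = ((‖ψ‖⁻¹ - 1 : ℝ) : ℂ) • ψ := by
    rw [normalized, Complex.ofReal_sub, Complex.ofReal_one, sub_smul, one_smul]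
  rw [e, norm_smul, Complex.norm_real, Real.norm_eq_abs, ← abs_of_nonneg (norm_nonneg ψ),
    ← abs_mul, abs_of_nonneg (norm_nonneg ψ), sub_mul, inv_mul_cancel₀ h0, one_mul]

theorem natCeil_le_ceil_div {α r : ℝ} (hα : 0 ≤ α) (hr : 0 < r) (hr1 : r ≤ 1) :
    (⌈α⌉₊ : ℤ) ≤ ⌈|α| / r⌉ := by
  rw [Int.natCast_ceil_eq_ceil hα, abs_of_nonneg hα]
  refine Int.ceil_le_ceil ?_
  rw [le_div_iff₀ hr]
  nlinarith

end Simulation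

theorem theorem2 :
    ∃ K : ℕ, ∀ (N : ℕ) (chain : OscillatorChain N) (a : ℕ) (αH : ℝ)
      (u : List (LocalGate (Fin a ⊕ Fin (OscillatorChain.indexQubits N + 1)))),
      IsBlockEncoding αH 0 (evalLocal u) chain.hamiltonian →
      ∀ t : ℝ, 0 ≤ t →
      -- a block encoding of the evolution operator, and its amplification
      (∀ ε : ℝ, 0 < ε → ε < 1 → ∀ αHS : ℝ, 4 ≤ αHS →
        ∃ V : Circuit 3 a,
          IsBlockEncoding αHS ε (V.eval (evalLocal u)) (chain.evolution t) ∧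
          (V.callCost u.length : ℤ) ≤ (2 * ⌈2.8 * αH * t + Real.log (1 / ε)⌉ - 1) * u.length ∧
          (V.otherGates : ℤ) ≤ K * (2 * ⌈2.8 * αH * t + Real.log (1 / ε)⌉ - 1) ∧
          ∀ ψ₀ : QState (Fin (OscillatorChain.indexQubits N + 1)), ψ₀ ≠ 0 → ‖ψ₀‖ ≤ 1 →
            ∃ (m : ℕ) (θ : ℝ), (m : ℤ) ≤ ⌈|αHS| / ‖ψ₀‖⌉ ∧
              let C : Circuit 4 a := (V.damp θ).amplify m
              let out := outputState (C.eval (evalLocal u)) (normalized ψ₀)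
              let target := applyOp (chain.evolution t) (normalized ψ₀)
              (C.callCost u.length : ℤ) ≤
                (2 * ⌈|αHS| / ‖ψ₀‖⌉ + 1) *
                  (2 * ⌈2.8 * αH * t + Real.log (1 / ε)⌉ - 1) * u.length ∧
              (C.otherGates : ℤ) ≤
                K * ((2 * ⌈|αHS| / ‖ψ₀‖⌉ + 1) *
                  (2 * ⌈2.8 * αH * t + Real.log (1 / ε)⌉ - 1)) ∧
              ‖out - target‖ ≤ ε ∧
              1 - ε ≤ ‖out‖ ^ 2 ∧
              ‖normalized out - target‖ ≤ ε) ∧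
      -- robust amplification of an arbitrary block encoding of the evolution operator
      (∀ (b : ℕ) (V : Circuit b a) (αHS δ : ℝ),
        IsBlockEncoding αHS δ (V.eval (evalLocal u)) (chain.evolution t) →
        ∀ ψ₀ : QState (Fin (OscillatorChain.indexQubits N + 1)), ψ₀ ≠ 0 → ‖ψ₀‖ ≤ 1 →
          ∃ (m : ℕ) (θ : ℝ), (m : ℤ) ≤ ⌈|αHS| / ‖ψ₀‖⌉ ∧
            let C : Circuit (b + 1) a := (V.damp θ).amplify m
            let out := outputState (C.eval (evalLocal u)) (normalized ψ₀)
            let target := applyOp (chain.evolution t) (normalized ψ₀)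
            (C.callCost u.length : ℤ) ≤
              (2 * ⌈|αHS| / ‖ψ₀‖⌉ + 1) * (V.callCost u.length : ℤ) ∧
            (C.otherGates : ℤ) ≤ K * ((2 * ⌈|αHS| / ‖ψ₀‖⌉ + 1) * (V.otherGates + 1)) ∧
            ‖out - target‖ ≤ K * δ) := by
  -- `16` is the constant of robust amplification, and it also covers the gate counts: for `V`, `6 l
  -- + 6 ≤ 16 (2 l + 1)`.
  refine ⟨16, fun N chain a αH u hu t ht => ?_⟩
  have hU := hu.unitary
  have hH := chain.hamiltonian_isHermitian
  have hW : chain.evolution t ∈ Matrix.unitaryGroup _ ℂ := evolution_mem_unitaryGroup hH t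
  have hblock : (αH : ℂ) • zeroBlock (evalLocal u) = chain.hamiltonian := by
    have h := norm_le_zero_iff.mp hu.error_le
    exact (sub_eq_zero.mp (EmbeddingLike.map_eq_zero_iff.mp h)).symm
  refine ⟨fun ε hε hε1 αHS hαHS => ?_, fun b V αHS δ hV ψ₀ hψ₀ hψ₁ => ?_⟩
  · have hlog : 0 < Real.log (1 / ε) := Real.log_pos (by rw [lt_div_iff₀ hε]; linarith)
    have hpos : 0 < 2.8 * αH * t + Real.log (1 / ε) := by
      have := mul_nonneg hu.nonneg ht
      nlinarith
    -- The ceiling is positive because `log (1 / ε) > 0`. Writing it as `l + 1` makes the number of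
    -- calls `2 l + 1`.
    obtain ⟨l, hl⟩ : ∃ l : ℕ, ⌈2.8 * αH * t + Real.log (1 / ε)⌉ = ((l + 1 : ℕ) : ℤ) := by
      have h1 := Int.ceil_pos.mpr hpos
      refine ⟨(⌈2.8 * αH * t + Real.log (1 / ε)⌉ - 1).toNat, ?_⟩
      push_cast
      omega
    have hle : 2.8 * αH * t + Real.log (1 / ε) ≤ ((l + 1 : ℕ) : ℝ) := by
      have := Int.le_ceil (2.8 * αH * t + Real.log (1 / ε))
      rw [hl] at this
      exact_mod_cast this
    obtain ⟨V, hV1, hV2, hV⟩ :=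
      exists_evolution_circuit hU hH hu.nonneg hblock ht hε hε1 hαHS hle
    have hD : 2 * ((l + 1 : ℕ) : ℤ) - 1 = ((2 * l + 1 : ℕ) : ℤ) := by push_cast; ring
    rw [hl, hD]
    refine ⟨V, ⟨hV.unitary, hV.nonneg, hV.error_le.trans (by linarith)⟩, ?_, ?_,
      fun ψ₀ hψ₀ hψ₁ => ⟨⌈αHS⌉₊, dampAngle αHS, ?_⟩⟩
    · rw [Circuit.callCost, hV1]
      push_cast
      exact le_rfl
    · rw [hV2]
      push_cast
      omega
    have hm := natCeil_le_ceil_div hV.nonneg (norm_pos_iff.mpr hψ₀) hψ₁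
    have hψ := norm_normalized hψ₀
    have hclose := norm_amplify_sub_le_four_mul hU hW hV (by linarith) hψ
    refine ⟨hm, ?_⟩
    set m := ⌈αHS⌉₊
    set k := ⌈|αHS| / ‖ψ₀‖⌉
    intro C out target
    -- Half of the error budget is used here. The norm of `out` is then within `ε / 2` of one, which
    -- bounds the cost of normalizing by the other half and gives a flag probability of at least `(1
    -- - ε / 2)² ≥ 1 - ε`.
    have hclose' : ‖out - target‖ ≤ ε / 2 := hclose.trans (le_of_eq (by ring))
    have htarget : ‖target‖ = 1 := (norm_applyOp_of_mem_unitaryGroup hW _).trans hψ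
    have hout : |1 - ‖out‖| ≤ ε / 2 := by
      rw [← htarget, abs_sub_comm]
      exact (abs_norm_sub_norm_le _ _).trans hclose'
    obtain ⟨hout1, hout2⟩ := abs_le.mp hout
    refine ⟨?_, ?_, by linarith, by nlinarith, ?_⟩
    · rw [Circuit.callCost, Circuit.calls_amplify, Circuit.calls_damp, hV1]
      push_cast
      gcongr
    · rw [Circuit.otherGates_amplify, Circuit.otherGates_damp, hV2]
      push_cast
      have hm0 : (0 : ℤ) ≤ m := by positivity
      have hl0 : (0 : ℤ) ≤ l := by positivity
      nlinarith [mul_le_mul_of_nonneg_right hm hl0]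
    · have hne : out ≠ 0 := by
        intro h
        rw [h, norm_zero] at hout2
        linarith
      calc ‖normalized out - target‖ ≤ ‖normalized out - out‖ + ‖out - target‖ :=
            norm_sub_le_norm_sub_add_norm_sub _ _ _
        _ ≤ ε / 2 + ε / 2 := add_le_add ((norm_normalized_sub hne).le.trans hout) hclose'
        _ = ε := by ring
  · have hm := natCeil_le_ceil_div hV.nonneg (norm_pos_iff.mpr hψ₀) hψ₁
    refine ⟨⌈αHS⌉₊, dampAngle αHS, hm, ?_⟩
    set m := ⌈αHS⌉₊
    set k := ⌈|αHS| / ‖ψ₀‖⌉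
    intro C out target
    refine ⟨?_, ?_, ?_⟩
    · rw [Circuit.callCost, Circuit.callCost, Circuit.calls_amplify, Circuit.calls_damp, mul_assoc]
      push_cast
      gcongr
    · rw [Circuit.otherGates_amplify, Circuit.otherGates_damp]
      push_cast
      have hm0 : (0 : ℤ) ≤ m := by positivity
      have hg0 : (0 : ℤ) ≤ V.otherGates := by positivity
      nlinarith [mul_le_mul_of_nonneg_right hm hg0, mul_nonneg hm0 hg0]
    · exact norm_amplify_sub_le_sixteen_mul hU hW hV (norm_normalized hψ₀)
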